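/- Let $\mathfrak g$ be a finite-dimensional real nilpotent Lie algebra with $1$-dimensional center $\mathfrak z$, let $G=(\mathfrak g,\cdot)$ be the corresponding connected simply connected nilpotent Lie group, where $x\cdot y$ is the Baker–Campbell–Hausdorff product, and let $X_1,\dots,X_n$ be a Jordan–Hölder basis of $\mathfrak g$, that is, $[\mathfrak g,X_j]\subseteq\mathrm{span}\{X_1,\dots,X_{j-1}\}$ for $j=1,\dots,n$; in particular $\mathfrak z=\mathbb R X_1$. Let $\pi$ be a continuous irreducible unitary representation of $G$ that is square-integrable modulo its center and satisfies $\pi(tX_1)=e^{it}\,\mathrm{id}$ for all $t\in\mathbb R$ (equivalently, $\pi$ is associated with the flat coadjoint orbit $\{\xi\in\mathfrak g^*:\langle\xi,X_1\rangle=1\}$). Put $\mathfrak g_e=\mathrm{span}\{X_2,\dots,X_n\}$, with a Lebesgue measure $dx$, and for $x,y\in\mathfrak g_e$ write $x\cdot y=x\cdot_e y+\alpha(x,y)X_1$ with $x\cdot_e y\in\mathfrak g_e$ and $\alpha(x,y)\in\mathbb R$. The twisted convolution of functions on $\mathfrak g_e$ is $$(\varphi\ast_e\psi)(x)=\int_{\mathfrak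 g_e}\varphi(x\cdot_e(-y))\,e^{i\alpha(x\cdot_e(-y),y)}\,\psi(y)\,dy=\int_{\mathfrak g_e}e^{i\alpha(-x,y)}\varphi(y)\,\psi((-y)\cdot_e x)\,dy ,$$ and for a tempered distribution $u\in\mathcal S'(\mathfrak g_e)$ and $\varphi\in\mathcal S(\mathfrak g_e)$ one defines the function $u\ast_e\varphi$ on $\mathfrak g_e$ by $$(u\ast_e\varphi)(x)=\big\langle u,\ y\mapsto e^{i\alpha(-x,y)}\varphi((-y)\cdot_e x)\big\rangle ,$$ where the function of $y$ on the right belongs to $\mathcal S(\mathfrak g_e)$ for every $x$. Let $1\le p\le q\le\infty$ and let $C\colon L^p(\mathfrak g_e)\to L^q(\mathfrak g_e)$ be a bounded linear operator such that $C(\varphi\ast_e\psi)=(C\varphi)\ast_e\psi$ for all $\varphi,\psi\in L^1(\mathfrak g_e)\cap L^p(\mathfrak g_e)$. Then there exists a unique $u\in\mathcal S'(\mathfrak g_e)$ such that $C\varphi=u\ast_e\varphi$ (almost everywhere) for every $\varphi\in\mathcal S(\mathfrak g_e)$. -/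

import Mathlib

open MeasureTheory SchwartzMap
open scoped ENNReal

namespace Pedersen

/-! ## The Baker-Campbell-Hausdorff multiplication of a nilpotent Lie algebra -/

section BCH

variable {g : Type*} [LieRing g] [LieAlgebra ℝ g]

/-- The right-nested bracket `⁅a₁, ⁅a₂, ⋯ ⁅a_{d-1}, a_d⁆⋯⁆⁆` of a word `a₁ a₂ ⋯ a_d`
(a word with a single letter `a` gives `a`). -/
def nestedBracket : List g → g
  | [] => 0
  | [a] => a
  | a :: b :: l => ⁅a, nestedBracket (b :: l)⁆

/-- The word `x^{p₁} y^{q₁} x^{p₂} y^{q₂} ⋯ x^{p_k} y^{q_k}`, where `s i = (p_i, q_i)`. -/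
def dynkinWord (x y : g) {k N : ℕ} (s : Fin k → Fin N × Fin N) : List g :=
  (List.ofFn fun i : Fin k =>
    List.replicate (s i).1 x ++ List.replicate (s i).2 y).flatten

/-- The Baker-Campbell-Hausdorff product `x · y = log (exp x exp y)`, given by Dynkin's formula
`∑_{k ≥ 1} (-1)^{k-1}/k ∑ [x^{p₁} y^{q₁} ⋯ x^{p_k} y^{q_k}] / ((∑ (p_i + q_i)) ∏ p_i! q_i!)`,
where the inner sum runs over all `p_i, q_i ≥ 0` with `p_i + q_i > 0`, and `[w]` is the right-nested
bracket of the word `w`.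
In a nilpotent Lie algebra of nilpotency class `c`, brackets of words of length `> c` vanish, so it
is enough to let `k`, `p_i` and `q_i` be at most `c`. -/
noncomputable def bch (x y : g) : g :=
  let c := LieModule.nilpotencyLength g g
  ∑ k ∈ Finset.Icc 1 c, ((-1 : ℝ) ^ (k - 1) / (k : ℝ)) •
    ∑ s : Fin k → Fin (c + 1) × Fin (c + 1) with ∀ i, 0 < ((s i).1 : ℕ) + ((s i).2 : ℕ),
      ((∑ i, (((s i).1 : ℕ) + ((s i).2 : ℕ) : ℝ)) *
        ∏ i, ((((s i).1 : ℕ).factorial : ℝ) * (((s i).2 : ℕ).factorial : ℝ)))⁻¹ •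
          nestedBracket (dynkinWord x y s)

end BCH

section Setting

variable {g : Type*} [LieRing g] [LieAlgebra ℝ g] {m : ℕ}

/-- `X = (X₁, …, X_n)`, with `n = m + 1` and `X₁ = X 0`, is a Jordan-Hölder basis: for
`g_j = span {X₁, …, X_j}` one has `[g, g_j] ⊆ g_{j-1}`. -/
def IsJordanHolder (X : Module.Basis (Fin (m + 1)) ℝ g) : Prop :=
  ∀ (j : Fin (m + 1)) (y : g), ⁅y, X j⁆ ∈ Submodule.span ℝ (X '' Set.Iio j)

/-- The space `g_e = ℝ X₂ ⊕ ⋯ ⊕ ℝ X_n` is identified with `ℝ^{n-1}` through the basis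
`X₂, …, X_n`; this is the inclusion of `g_e` into `g`. -/
noncomputable def incl (X : Module.Basis (Fin (m + 1)) ℝ g) (x : EuclideanSpace ℝ (Fin m)) : g :=
  ∑ j : Fin m, x j • X j.succ

/-- The projection of `g = g_e ⊕ ℝ X₁` onto `g_e`. -/
noncomputable def proj (X : Module.Basis (Fin (m + 1)) ℝ g) (z : g) : EuclideanSpace ℝ (Fin m) :=
  WithLp.toLp 2 fun j : Fin m => X.repr z j.succ

/-- The multiplication `x ·_e y` of `g_e`: the projection onto `g_e` of `x · y`. -/
noncomputable def mulE (X : Module.Basis (Fin (m + 1)) ℝ g) (x y : EuclideanSpace ℝ (Fin m)) :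
    EuclideanSpace ℝ (Fin m) :=
  proj X (bch (incl X x) (incl X y))

/-- The functional `ξ₀` on `g` with `⟨ξ₀, X₁⟩ = 1` which vanishes on `g_e`. -/
noncomputable def xi0 (X : Module.Basis (Fin (m + 1)) ℝ g) : Module.Dual ℝ g := X.coord 0

/-- `α(x, y) = ⟨ξ₀, x · y⟩` for `x, y ∈ g_e`, so that `x · y = x ·_e y + α(x, y) X₁`. -/
noncomputable def alpha (X : Module.Basis (Fin (m + 1)) ℝ g) (x y : EuclideanSpace ℝ (Fin m)) :
    ℝ :=
  xi0 X (bch (incl X x) (incl X y))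

/-- `π` is a continuous irreducible unitary representation on `H` of the simply connected
nilpotent Lie group `(g, ·)`, it is associated with the coadjoint orbit
`{ξ ∈ g^* | ⟨ξ, X₁⟩ = 1}`, i.e. `π(t X₁) = e^{i t}`, and it is square-integrable modulo the
center `ℝ X₁`. -/
structure IsSquareIntegrableRep (X : Module.Basis (Fin (m + 1)) ℝ g)
    {H : Type*} [NormedAddCommGroup H] [InnerProductSpace ℂ H] [CompleteSpace H]
    (π : g → (H →L[ℂ] H)) : Prop where
  unitary : ∀ x, π x ∈ unitary (H →L[ℂ] H)
  map_mul : ∀ x y, π (bch x y) = π x * π y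
  /-- strong continuity, in the coordinates of the basis `X` -/
  continuous : ∀ v : H, Continuous fun c : Fin (m + 1) → ℝ => π (∑ j, c j • X j) v
  nontrivial : Nontrivial H
  irreducible : ∀ W : Submodule ℂ H, IsClosed (W : Set H) →
    (∀ x, ∀ w ∈ W, π x w ∈ W) → W = ⊥ ∨ W = ⊤
  central_character : ∀ t : ℝ, π (t • X 0) = Complex.exp (Complex.I * t) • 1
  /-- Some matrix coefficient with nonzero vectors is square-integrable on `G/Z ≃ g_e` (its
  absolute value is constant on the cosets of `Z`). -/
  square_integrable : ∃ v w : H, v ≠ 0 ∧ w ≠ 0 ∧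
    MemLp (fun x : EuclideanSpace ℝ (Fin m) => inner ℂ w (π (incl X x) v)) 2 volume

/-- The twisted convolution of two functions on `g_e`,
`(φ ∗_e ψ)(x) = ∫ φ(x ·_e (-y)) e^{i α(x ·_e (-y), y)} ψ(y) dy`. -/
noncomputable def twistedConv (X : Module.Basis (Fin (m + 1)) ℝ g)
    (μ : Measure (EuclideanSpace ℝ (Fin m))) (φ ψ : EuclideanSpace ℝ (Fin m) → ℂ) :
    EuclideanSpace ℝ (Fin m) → ℂ := fun x =>
  ∫ y, φ (mulE X x (-y)) * Complex.exp (Complex.I * alpha X (mulE X x (-y)) y) * ψ y ∂μ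

/-- `f` is the function `u ∗_e φ`, the twisted convolution of the tempered distribution `u` with
the Schwartz function `φ`: for all `x`, the function `y ↦ e^{i α(-x, y)} φ((-y) ·_e x)` is a Schwartz
function, and `f x` is the value of `u` on it. When `u` is (integration against) a function, this is
`f x = ∫ u(y) e^{i α(-x, y)} φ((-y) ·_e x) dy`, which is the twisted convolution of `u` and `φ` after
the change of variables `y ↦ (-y) ·_e x`. -/
def IsTwistedConvDistrib (X : Module.Basis (Fin (m + 1)) ℝ g)
    (u : 𝓢'(EuclideanSpace ℝ (Fin m), ℂ)) (φ : 𝓢(EuclideanSpace ℝ (Fin m), ℂ))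
    (f : EuclideanSpace ℝ (Fin m) → ℂ) : Prop :=
  ∀ x, ∃ k : 𝓢(EuclideanSpace ℝ (Fin m), ℂ),
    (∀ y, k y = Complex.exp (Complex.I * alpha X (-x) y) * φ (mulE X (-y) x)) ∧ f x = u k

end Setting

end Pedersen

/-! Write `(R_a φ)(x) = e^{-iα(x,a)} φ(x ·_e a)` for the twisted right translations. Since `φ ∗_e ψ
= ∫ ψ(y) R_{-y} φ dy`, an operator `C` commuting with right twisted convolutions commutes with every
`R_a`, so formally `(Cφ)(a) = (C R_a φ)(0) = u(R_a φ)` with `u(φ) = (Cφ)(0)`. Up to the reflection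
`y ↦ -y` this is the twisted convolution of a distribution with `φ`. What must be shown is that
`Cφ`, a class in `L^q`, has a value at `0` depending continuously on `φ`.

This comes from a factorization of Schwartz functions (`exists_factorization`). The value of a
Schwartz function at `0` is the integral of a power of `1 - (2π)⁻²Δ` of it against a fixed
continuous function. Applied to `y ↦ χ(y) (R_{-y} φ)(x)`, with a cutoff `χ` equal to `1` near `0`,
this gives `φ = ∑ (D_i φ) ∗_e ψ_i`, where the `D_i` are continuous operators on Schwartz space and
the `ψ_i` are continuous with compact support. Hence `Cφ = ∑ C(D_i φ) ∗_e ψ_i` almost everywhere.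
The right side is continuous, and its value at `0` is a continuous functional of `φ`
(`exists_continuous_ae_eq`). Commutation with `R_a` follows by approximating `R_a φ` in `L^p` by
twisted convolutions with bumps shrinking to `-a` (`apply_rtrans_eq`). Uniqueness holds because `x ↦
u(R_x φ)` is continuous and equals `u(φ)` at `0`.

All this takes place in a group with a cocycle (`IsTwistedGroup`), which requires the
Baker–Campbell–Hausdorff product to be associative. Here associativity is deduced from the
representation: `π` takes the same value on both bracketings, and its kernel is discrete by
square-integrability, so the set where the bracketings agree is open and closed (`bch_assoc`). -/

namespace Pedersen

/-! ### The Baker–Campbell–Hausdorff product as a combination of iterated brackets. -/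

section Words

variable {g : Type*} [LieRing g] [LieAlgebra ℝ g]

/-- The right-nested bracket of the word obtained from a pattern by substituting `x` and `y`. -/
def wordBracket (w : List Bool) (x y : g) : g := nestedBracket (w.map fun b => cond b x y)

/-- The pattern `x^{p₁} y^{q₁} ⋯ x^{p_k} y^{q_k}` of a Dynkin word. -/
def dynkinPattern {k N : ℕ} (s : Fin k → Fin N × Fin N) : List Bool :=
  (List.ofFn fun i : Fin k =>
    List.replicate (s i).1 true ++ List.replicate (s i).2 false).flatten

lemma dynkinWord_eq_map {g : Type*} (x y : g) {k N : ℕ} (s : Fin k → Fin N × Fin N) :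
    dynkinWord x y s = (dynkinPattern s).map fun b => cond b x y := by
  simp [dynkinWord, dynkinPattern, List.map_flatten, Function.comp_def, List.map_ofFn]

lemma length_dynkinPattern {k N : ℕ} (s : Fin k → Fin N × Fin N) :
    (dynkinPattern s).length = ∑ i, (((s i).1 : ℕ) + ((s i).2 : ℕ)) := by
  simp [dynkinPattern, List.length_flatten, List.map_ofFn, Function.comp_def, List.sum_ofFn]

lemma nestedBracket_cons {g : Type*} [LieRing g] (a : g) {l : List g} (hl : l ≠ []) :
    nestedBracket (a :: l) = ⁅a, nestedBracket l⁆ := by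
  cases l with
  | nil => exact absurd rfl hl
  | cons b l => rfl

variable (g) in
/-- The span of the bracket expressions in two variables of degree at least two. -/
def higherBrackets : Submodule ℝ (g → g → g) :=
  Submodule.span ℝ (wordBracket '' {w : List Bool | 2 ≤ w.length})

lemma wordBracket_mem_higherBrackets {w : List Bool} (hw : 2 ≤ w.length) :
    wordBracket w ∈ higherBrackets g :=
  Submodule.subset_span ⟨w, hw, rfl⟩

lemma le_length_dynkinPattern {k N : ℕ} (s : Fin k → Fin N × Fin N)
    (hs : ∀ i, 0 < ((s i).1 : ℕ) + ((s i).2 : ℕ)) : k ≤ (dynkinPattern s).length := by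
  rw [length_dynkinPattern]
  calc k = ∑ _i : Fin k, 1 := by simp
    _ ≤ _ := Finset.sum_le_sum fun i _ => hs i

/-- The coefficient of a Dynkin word. -/
noncomputable def dynkinCoeff {k N : ℕ} (s : Fin k → Fin N × Fin N) : ℝ :=
  ((∑ i, (((s i).1 : ℕ) + ((s i).2 : ℕ) : ℝ)) *
        ∏ i, ((((s i).1 : ℕ).factorial : ℝ) * (((s i).2 : ℕ).factorial : ℝ)))⁻¹

lemma bch_eq_sum : (bch : g → g → g) =
    ∑ k ∈ Finset.Icc 1 (LieModule.nilpotencyLength g g), ((-1 : ℝ) ^ (k - 1) / (k : ℝ)) •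
      ∑ s : Fin k → Fin (LieModule.nilpotencyLength g g + 1) ×
        Fin (LieModule.nilpotencyLength g g + 1) with ∀ i, 0 < ((s i).1 : ℕ) + ((s i).2 : ℕ),
      dynkinCoeff s • (wordBracket (dynkinPattern s) : g → g → g) := by
  funext x y
  simp only [bch, Finset.sum_apply, Pi.smul_apply, wordBracket, dynkinWord_eq_map, dynkinCoeff]

/-- A Dynkin word with `k` blocks has length at least `k`, so words of length one occur only for `k
= 1`. They are `x` and `y`, each with coefficient `1`. -/
lemma bch_sub_add_mem_higherBrackets (hc : 1 ≤ LieModule.nilpotencyLength g g) :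
    (bch : g → g → g) - (fun x y => x + y) ∈ higherBrackets g := by
  rw [bch_eq_sum]
  set c := LieModule.nilpotencyLength g g
  have hins : Finset.Icc 1 c = insert 1 (Finset.Icc 2 c) := by
    ext k; simp; omega
  rw [hins, Finset.sum_insert (by simp), add_sub_right_comm]
  refine add_mem ?_ (Submodule.sum_mem _ fun k hk => Submodule.smul_mem _ _ <|
    Submodule.sum_mem _ fun s hs => Submodule.smul_mem _ _ <| wordBracket_mem_higherBrackets <|
      (Finset.mem_Icc.1 hk).1.trans (le_length_dynkinPattern s (Finset.mem_filter.1 hs).2))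
  have h1 : 1 < c + 1 := by omega
  -- The exponent patterns `(1, 0)` and `(0, 1)`, which produce the words `x` and `y`. The bound `1
  -- ≤ c` makes room for the exponent `1`.
  let s₁ : Fin 1 → Fin (c + 1) × Fin (c + 1) := fun _ => (⟨1, h1⟩, 0)
  let s₂ : Fin 1 → Fin (c + 1) × Fin (c + 1) := fun _ => (0, ⟨1, h1⟩)
  have hne : s₁ ≠ s₂ := fun h => by simpa [s₁, s₂, Fin.ext_iff] using congrFun h 0
  set S := Finset.univ.filter
    fun s : Fin 1 → Fin (c + 1) × Fin (c + 1) => ∀ i, 0 < ((s i).1 : ℕ) + ((s i).2 : ℕ)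
  have hS₁ : s₁ ∈ S := by
    simp only [S, s₁, Finset.mem_filter, Finset.mem_univ, true_and]
    exact fun _ => Nat.lt_add_right _ Nat.one_pos
  have hS₂ : s₂ ∈ S.erase s₁ := by
    simp only [S, s₂, Finset.mem_erase, Finset.mem_filter, Finset.mem_univ, true_and]
    exact ⟨hne.symm, fun _ => Nat.lt_add_left _ Nat.one_pos⟩
  have e₁ : dynkinCoeff s₁ • (wordBracket (dynkinPattern s₁) : g → g → g) = fun x _ => x := by
    funext x y; simp [dynkinCoeff, wordBracket, dynkinPattern, s₁, nestedBracket]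
  have e₂ : dynkinCoeff s₂ • (wordBracket (dynkinPattern s₂) : g → g → g) = fun _ y => y := by
    funext x y; simp [dynkinCoeff, wordBracket, dynkinPattern, s₂, nestedBracket]
  rw [← Finset.add_sum_erase S _ hS₁, ← Finset.add_sum_erase _ _ hS₂, e₁, e₂]
  have : (((-1 : ℝ) ^ (1 - 1) / ((1 : ℕ) : ℝ)) • ((fun x _ => x) + ((fun _ y => y) +
      ∑ s ∈ (S.erase s₁).erase s₂, dynkinCoeff s • (wordBracket (dynkinPattern s) : g → g → g)))) -
      (fun x y => x + y) =
      ∑ s ∈ (S.erase s₁).erase s₂, dynkinCoeff s • (wordBracket (dynkinPattern s) : g → g → g) := by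
    funext x y
    simp only [Pi.sub_apply, Pi.smul_apply, Pi.add_apply]
    simp
  rw [this]
  refine Submodule.sum_mem _ fun s hs => Submodule.smul_mem _ _ <|
    wordBracket_mem_higherBrackets ?_
  simp only [Finset.mem_erase, S, Finset.mem_filter, Finset.mem_univ, true_and] at hs
  obtain ⟨hs2, hs1, hs0⟩ := hs
  rw [length_dynkinPattern]
  simp only [Finset.univ_unique, Fin.default_eq_zero, Finset.sum_singleton]
  by_contra! hlt
  have h0 := hs0 0
  have hcase : (((s 0).1 : ℕ) = 1 ∧ ((s 0).2 : ℕ) = 0) ∨ (((s 0).1 : ℕ) = 0 ∧ ((s 0).2 : ℕ) = 1) := by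
    omega
  rcases hcase with h | h
  · refine hs1 (funext fun i => ?_)
    rw [Subsingleton.elim i 0]
    exact Prod.ext (Fin.ext h.1) (Fin.ext h.2)
  · refine hs2 (funext fun i => ?_)
    rw [Subsingleton.elim i 0]
    exact Prod.ext (Fin.ext h.1) (Fin.ext h.2)

/-- A property of bivariate expressions that is stable under linear combinations and holds for the
brackets of degree at least two holds for the difference of `bch x y` and `x + y`. -/
lemma bch_sub_add_induction (hc : 1 ≤ LieModule.nilpotencyLength g g) {P : (g → g → g) → Prop}
    (word : ∀ w : List Bool, 2 ≤ w.length → P (wordBracket w)) (zero : P 0)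
    (add : ∀ F F', P F → P F' → P (F + F')) (smul : ∀ (r : ℝ) F, P F → P (r • F)) :
    P ((bch : g → g → g) - fun x y => x + y) := by
  refine Submodule.span_induction (p := fun F _ => P F) ?_ zero (fun _ _ _ _ => add _ _)
    (fun r _ _ => smul r _) (bch_sub_add_mem_higherBrackets hc)
  rintro _ ⟨w, hw, rfl⟩
  exact word w hw

lemma nestedBracket_mem {V : Submodule ℝ g} {a b : g}
    (w : List Bool) (hw : 2 ≤ w.length) (hV : ∀ x ∈ ({a, b} : Set g), ∀ y ∈ ({a, b} : Set g), ⁅x, y⁆ ∈ V)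
    (hV' : ∀ x ∈ ({a, b} : Set g), ∀ y ∈ V, ⁅x, y⁆ ∈ V) : wordBracket w a b ∈ V := by
  have hmem : ∀ c : Bool, cond c a b ∈ ({a, b} : Set g) := by intro c; cases c <;> simp
  induction w with
  | nil => simp at hw
  | cons c w ih =>
    have hne : w.map (fun b' => cond b' a b) ≠ [] := by
      rintro h; rw [List.map_eq_nil_iff] at h; simp [h] at hw
    rw [wordBracket, List.map_cons, nestedBracket_cons _ hne]
    rcases w with _ | ⟨d, _ | ⟨e, w⟩⟩
    · simp at hne
    · exact hV _ (hmem c) _ (hmem d)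
    · exact hV' _ (hmem c) _ (ih (by simp))

lemma bch_of_commute (hc : 1 ≤ LieModule.nilpotencyLength g g) {x y : g} (h : ⁅x, y⁆ = 0) :
    bch x y = x + y := by
  have h' : ⁅y, x⁆ = 0 := by rw [← lie_skew, h, neg_zero]
  have := bch_sub_add_induction (g := g) hc (P := fun F => F x y = 0)
    (fun w hw => by
      have := nestedBracket_mem (V := ⊥) (a := x) (b := y) w hw
        (by
          rintro u (rfl | rfl) v (rfl | rfl) <;> simp [h, h']) (by simp)
      simpa using this)
    rfl (fun F F' h h' => by simp [h, h']) (fun r F h => by simp [h])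
  simpa [sub_eq_zero] using this

/-- Changing the letters by elements of `V` changes a word by an element of `V`, and each bracketing
improves this to `V'`. The weaker claim is carried along because it is all that holds for a
one-letter tail. -/
lemma nestedBracket_congr {V V' : Submodule ℝ g} (hle : V' ≤ V)
    (hbr : ∀ x : g, ∀ y ∈ V, ⁅x, y⁆ ∈ V') {x x' y y' : g} (hx : x - x' ∈ V) (hy : y - y' ∈ V)
    (w : List Bool) :
    wordBracket w x y - wordBracket w x' y' ∈ V ∧
      (2 ≤ w.length → wordBracket w x y - wordBracket w x' y' ∈ V') := by
  have hl : ∀ c : Bool, cond c x y - cond c x' y' ∈ V := by intro c; cases c <;> simpa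
  induction w with
  | nil => simp [wordBracket, nestedBracket]
  | cons c w ih =>
    rcases w with _ | ⟨d, w⟩
    · simpa [wordBracket, nestedBracket] using hl c
    · have key : wordBracket (c :: d :: w) x y - wordBracket (c :: d :: w) x' y' ∈ V' := by
        have e : ∀ u v : g, wordBracket (c :: d :: w) u v = ⁅cond c u v, wordBracket (d :: w) u v⁆ :=
          fun u v => rfl
        rw [e, e]
        have : ⁅cond c x y, wordBracket (d :: w) x y⁆ - ⁅cond c x' y', wordBracket (d :: w) x' y'⁆ =
            ⁅cond c x y, wordBracket (d :: w) x y - wordBracket (d :: w) x' y'⁆ -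
              ⁅wordBracket (d :: w) x' y', cond c x y - cond c x' y'⁆ := by
          rw [lie_sub, lie_sub, ← lie_skew (cond c x y) (wordBracket (d :: w) x' y'),
            ← lie_skew (cond c x' y') (wordBracket (d :: w) x' y')]
          abel
        rw [this]
        exact sub_mem (hbr _ _ ih.1) (hbr _ _ (hl c))
      exact ⟨hle key, fun _ => key⟩

/-- The nonlinear part of the product modulo `V'` sees its arguments only modulo `V`. With
consecutive members of the flag for `V'` and `V`, this is the source of every triangularity
statement below. -/
lemma bch_congr (hc : 1 ≤ LieModule.nilpotencyLength g g) {V V' : Submodule ℝ g} (hle : V' ≤ V)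
    (hbr : ∀ x : g, ∀ y ∈ V, ⁅x, y⁆ ∈ V') {x x' y y' : g} (hx : x - x' ∈ V) (hy : y - y' ∈ V) :
    (bch x y - (x + y)) - (bch x' y' - (x' + y')) ∈ V' :=
  bch_sub_add_induction (g := g) hc (P := fun F => F x y - F x' y' ∈ V')
    (fun w hw => (nestedBracket_congr hle hbr hx hy w).2 hw) (by simp)
    (fun F F' h h' => by
      simp only [Pi.add_apply]
      rw [add_sub_add_comm]
      exact add_mem h h')
    (fun r F h => by
      simp only [Pi.smul_apply]
      rw [← smul_sub]
      exact V'.smul_mem r h)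

end Words

end Pedersen

/-! ### Unipotent triangular maps preserve Lebesgue measure. -/

/-- A map of `ℝ^m` whose `j`-th coordinate differs from the `j`-th coordinate of the argument by a
function of the later coordinates preserves Lebesgue measure. -/
theorem measurePreserving_of_triangular : ∀ {m : ℕ} {T : (Fin m → ℝ) → (Fin m → ℝ)},
    Measurable T →
    (∀ (j : Fin m) (z z' : Fin m → ℝ), (∀ k, j < k → z k = z' k) → T z j - z j = T z' j - z' j) →
    MeasurePreserving T volume volume
  | 0, T, _, _ => by
    have : T = id := by funext z; exact Subsingleton.elim _ _
    rw [this]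
    exact MeasurePreserving.id _
  | m + 1, T, hT, h => by
    let e := MeasurableEquiv.piFinSuccAbove (fun _ : Fin (m + 1) => ℝ) 0
    have he : MeasurePreserving e volume (volume.prod volume) :=
      volume_preserving_piFinSuccAbove (fun _ : Fin (m + 1) => ℝ) 0
    have hcons : Measurable fun p : ℝ × (Fin m → ℝ) => (Fin.cons p.1 p.2 : Fin (m + 1) → ℝ) := by
      refine measurable_pi_iff.2 fun i => ?_
      refine Fin.cases ?_ (fun j => ?_) i
      · simpa using measurable_fst
      · simpa using! (measurable_pi_apply j).comp measurable_snd
    -- Putting `0` in the first coordinate loses nothing: no increment `T z j - z j` depends on `z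
    -- 0`. So `T` is a skew product, with the triangular map `T'` on the later coordinates and
    -- translation by `p` in the first.
    let T' : (Fin m → ℝ) → (Fin m → ℝ) := fun z j => T (Fin.cons 0 z) j.succ
    let p : (Fin m → ℝ) → ℝ := fun z => T (Fin.cons 0 z) 0
    have hc0 : Measurable fun z : Fin m → ℝ => T (Fin.cons 0 z) :=
      hT.comp (hcons.comp (measurable_const.prodMk measurable_id))
    have hT' : MeasurePreserving T' volume volume := by
      refine measurePreserving_of_triangular
        (measurable_pi_iff.2 fun j => (measurable_pi_apply j.succ).comp hc0) fun j z z' hz => ?_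
      have := h j.succ (Fin.cons 0 z) (Fin.cons 0 z') fun k hk => by
        refine Fin.cases (fun _ => by simp) (fun i hi => ?_) k hk
        simpa using hz i (by simpa using hi)
      simpa [T'] using this
    have hp : Measurable p := (measurable_pi_apply 0).comp hc0
    have hskew : MeasurePreserving (fun q : (Fin m → ℝ) × ℝ => (T' q.1, q.2 + p q.1))
        (volume.prod volume) (volume.prod volume) :=
      hT'.skew_product (g := fun z a => a + p z)
        (measurable_snd.add (hp.comp measurable_fst))
        (Filter.Eventually.of_forall fun z => (measurePreserving_add_right volume (p z)).map_eq)
    have hall := (he.symm e).comp (Measure.measurePreserving_swap.comp (hskew.comp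
      (Measure.measurePreserving_swap.comp he)))
    refine (congrArg (fun f => MeasurePreserving f volume volume) (funext fun z => ?_)).mp hall
    have hz : z = Fin.cons (z 0) (Fin.tail z) := (Fin.cons_self_tail z).symm
    simp only [Function.comp_apply]
    rw [MeasurableEquiv.symm_apply_eq]
    refine Prod.ext ?_ ?_
    · have := h 0 z (Fin.cons 0 (Fin.tail z)) fun k hk => by
        obtain ⟨i, rfl⟩ := Fin.exists_succ_eq.2 hk.ne'
        simp [Fin.tail]
      simp only [Fin.cons_zero, sub_zero] at this
      change z 0 + p (Fin.tail z) = T z 0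
      simp only [p]
      rw [← this]; ring
    · funext j
      have := h j.succ z (Fin.cons 0 (Fin.tail z)) fun k hk => by
        obtain ⟨i, rfl⟩ := Fin.exists_succ_eq.2 ((Fin.succ_pos j).trans hk).ne'
        simp [Fin.tail]
      simp only [Fin.cons_succ, Fin.tail, sub_left_inj] at this
      exact this.symm

theorem EuclideanSpace.measurePreserving_of_triangular {m : ℕ}
    {μ : Measure (EuclideanSpace ℝ (Fin m))} [μ.IsAddHaarMeasure]
    {T : EuclideanSpace ℝ (Fin m) → EuclideanSpace ℝ (Fin m)} (hT : Measurable T)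
    (h : ∀ (j : Fin m) (z z' : EuclideanSpace ℝ (Fin m)), (∀ k, j < k → z k = z' k) →
      T z j - z j = T z' j - z' j) : MeasurePreserving T μ μ := by
  have hv : MeasurePreserving T volume volume := by
    have e := EuclideanSpace.volume_preserving_symm_measurableEquiv_toLp (Fin m)
    have h1 : MeasurePreserving (fun z : Fin m → ℝ => (WithLp.ofLp (T (WithLp.toLp 2 z))))
        volume volume := by
      refine _root_.measurePreserving_of_triangular ?_ fun j z z' hz => h j _ _ hz
      exact (MeasurableEquiv.toLp 2 _).symm.measurable.comp
        (hT.comp (MeasurableEquiv.toLp 2 _).measurable)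
    exact (e.symm.comp h1).comp e
  rw [Measure.isAddLeftInvariant_eq_smul μ volume]
  exact hv.smul_measure _

/-! ### The Jordan–Hölder flag and elementary identities for the product. -/

namespace Pedersen

variable {g : Type*} [LieRing g] [LieAlgebra ℝ g] {m : ℕ}

/-- The span of the first `j` basis vectors. -/
def flag (X : Module.Basis (Fin (m + 1)) ℝ g) (j : ℕ) : Submodule ℝ g where
  carrier := {z | ∀ i : Fin (m + 1), j ≤ i → X.repr z i = 0}
  add_mem' h h' i hi := by simp [h i hi, h' i hi]
  zero_mem' i _ := by simp
  smul_mem' r z h i hi := by simp [h i hi]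

variable {X : Module.Basis (Fin (m + 1)) ℝ g}

lemma flag_mono {j k : ℕ} (h : j ≤ k) : flag X j ≤ flag X k := fun _ hz i hi => hz i (h.trans hi)

lemma lie_mem_flag (hX : IsJordanHolder X) (j : ℕ) (x : g) {y : g} (hy : y ∈ flag X (j + 1)) :
    ⁅x, y⁆ ∈ flag X j := by
  rw [← X.sum_repr y, lie_sum]
  refine Submodule.sum_mem _ fun i _ => ?_
  rw [lie_smul]
  by_cases hi : j + 1 ≤ i
  · rw [hy i hi, zero_smul]; exact zero_mem _
  · refine Submodule.smul_mem _ _ ?_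
    have h := hX i x
    rw [Module.Basis.mem_span_image] at h
    intro k hk
    by_contra hne
    have : k ∈ (X.repr ⁅x, X i⁆).support := Finsupp.mem_support_iff.2 hne
    have hlt : k < i := h this
    rw [Fin.lt_def] at hlt
    omega

lemma flag_zero : flag X 0 = ⊥ := by
  rw [eq_bot_iff]
  intro z hz
  rw [Submodule.mem_bot, ← X.repr.map_eq_zero_iff]
  ext i
  exact hz i (Nat.zero_le _)

lemma basis_mem_flag (i : Fin (m + 1)) : X i ∈ flag X (i + 1) := by
  intro k hk
  rw [X.repr_self, Finsupp.single_apply, if_neg]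
  rintro rfl
  omega

/-- In class `0` the sum defining `bch` would be empty. A basis indexed by `Fin (m + 1)` rules this
out. -/
lemma one_le_nilpotencyLength [LieRing.IsNilpotent g] (X : Module.Basis (Fin (m + 1)) ℝ g) :
    1 ≤ LieModule.nilpotencyLength g g := by
  rw [Nat.one_le_iff_ne_zero]
  intro h
  rw [LieModule.nilpotencyLength_eq_zero_iff] at h
  exact X.ne_zero 0 (Subsingleton.elim _ _)

lemma repr_incl_succ (x : EuclideanSpace ℝ (Fin m)) (j : Fin m) :
    X.repr (incl X x) j.succ = x j := by
  simp [incl, Finsupp.single_apply]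

lemma repr_incl_zero (x : EuclideanSpace ℝ (Fin m)) : X.repr (incl X x) 0 = 0 := by
  simp [incl]

variable [LieRing.IsNilpotent g]

/-- This is `bch_congr` with `V = ℝ X₁` and `V' = 0`. -/
lemma bch_add_center (hX : IsJordanHolder X) (x y : g) (s t : ℝ) :
    bch (x + s • X 0) (y + t • X 0) = bch x y + (s + t) • X 0 := by
  have hmem : ∀ r : ℝ, r • X 0 ∈ flag X (0 + 1) := fun r =>
    Submodule.smul_mem _ _ (basis_mem_flag 0)
  have := bch_congr (one_le_nilpotencyLength X) (flag_mono (X := X) (Nat.zero_le 1))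
    (fun x y => lie_mem_flag hX 0 x) (x := x + s • X 0) (x' := x) (y := y + t • X 0) (y' := y)
    (by simpa using hmem s) (by simpa using hmem t)
  rw [flag_zero, Submodule.mem_bot, sub_eq_zero, sub_eq_iff_eq_add] at this
  rw [this, add_smul]
  abel

lemma bch_smul_smul (X : Module.Basis (Fin (m + 1)) ℝ g) (x : g) (s t : ℝ) :
    bch (s • x) (t • x) = (s + t) • x := by
  rw [bch_of_commute (one_le_nilpotencyLength X) (by simp), add_smul]

lemma bch_zero (X : Module.Basis (Fin (m + 1)) ℝ g) (x : g) : bch x 0 = x := by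
  simpa using bch_smul_smul X x 1 0

lemma zero_bch (X : Module.Basis (Fin (m + 1)) ℝ g) (x : g) : bch 0 x = x := by
  simpa using bch_smul_smul X x 0 1

lemma bch_neg (X : Module.Basis (Fin (m + 1)) ℝ g) (x : g) : bch x (-x) = 0 := by
  simpa using bch_smul_smul X x 1 (-1)

end Pedersen

/-! ### Coordinates on `g_e`: splitting, temperate growth, invariance of the measure. -/

namespace Pedersen

section

variable {g : Type*} [LieRing g] [LieAlgebra ℝ g] {m : ℕ} {X : Module.Basis (Fin (m + 1)) ℝ g}

lemma incl_eq_sum_cons (x : EuclideanSpace ℝ (Fin m)) :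
    incl X x = ∑ j, (Fin.cons 0 (fun j => x j) : Fin (m + 1) → ℝ) j • X j := by
  rw [Fin.sum_univ_succ]
  simp [incl]

lemma incl_neg (x : EuclideanSpace ℝ (Fin m)) : incl X (-x) = -incl X x := by
  simp [incl]

lemma incl_zero : incl X (0 : EuclideanSpace ℝ (Fin m)) = 0 := by
  simp [incl]

lemma proj_apply (z : g) (j : Fin m) : proj X z j = X.repr z j.succ := rfl

lemma xi0_apply (z : g) : xi0 X z = X.repr z 0 := rfl

lemma incl_proj_add (z : g) : incl X (proj X z) + xi0 X z • X 0 = z := by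
  conv_rhs => rw [← X.sum_repr z, Fin.sum_univ_succ, add_comm]
  simp [incl, proj_apply, xi0_apply]

lemma proj_incl_add (x : EuclideanSpace ℝ (Fin m)) (t : ℝ) : proj X (incl X x + t • X 0) = x := by
  ext j
  rw [proj_apply, map_add, Finsupp.add_apply, repr_incl_succ]
  simp

lemma xi0_incl_add (x : EuclideanSpace ℝ (Fin m)) (t : ℝ) : xi0 X (incl X x + t • X 0) = t := by
  rw [xi0_apply, map_add, Finsupp.add_apply, repr_incl_zero]
  simp

lemma bch_incl_incl (x y : EuclideanSpace ℝ (Fin m)) :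
    bch (incl X x) (incl X y) = incl X (mulE X x y) + alpha X x y • X 0 :=
  (incl_proj_add _).symm

lemma mulE_eq_of_bch_eq {x y z : EuclideanSpace ℝ (Fin m)} {t : ℝ}
    (h : bch (incl X x) (incl X y) = incl X z + t • X 0) : mulE X x y = z ∧ alpha X x y = t := by
  rw [mulE, alpha, h]
  exact ⟨proj_incl_add _ _, xi0_incl_add _ _⟩

/-! ### Polynomial growth of the coordinates -/

variable {D : Type*} [NormedAddCommGroup D] [NormedSpace ℝ D]

/-- All the coordinates of a map into `g` have temperate growth. -/
def CoordTemperate (X : Module.Basis (Fin (m + 1)) ℝ g) (F : D → g) : Prop :=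
  ∀ i, (fun d => X.repr (F d) i).HasTemperateGrowth

lemma CoordTemperate.add {F F' : D → g} (h : CoordTemperate X F) (h' : CoordTemperate X F') :
    CoordTemperate X fun d => F d + F' d := fun i => by
  simpa using! (h i).add (h' i)

lemma CoordTemperate.const_smul {F : D → g} (h : CoordTemperate X F) (r : ℝ) :
    CoordTemperate X fun d => r • F d := fun i => by
  simpa using! (Function.HasTemperateGrowth.const r).mul (h i)

lemma CoordTemperate.zero : CoordTemperate X fun _ : D => (0 : g) := fun i => by
  simpa only [map_zero, Finsupp.zero_apply] using Function.HasTemperateGrowth.zero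

/-- Through the structure constants, the coordinates of a bracket are bilinear in those of its two
entries. -/
lemma CoordTemperate.lie {F F' : D → g} (h : CoordTemperate X F) (h' : CoordTemperate X F') :
    CoordTemperate X fun d => ⁅F d, F' d⁆ := fun i => by
  have e : (fun d => X.repr ⁅F d, F' d⁆ i) = fun d => ∑ j, ∑ k,
      X.repr (F d) j * (X.repr (F' d) k * X.repr ⁅X j, X k⁆ i) := by
    funext d
    conv_lhs => rw [← X.sum_repr (F d), ← X.sum_repr (F' d)]
    simp only [sum_lie, lie_sum, smul_lie, lie_smul, map_sum, map_smul,
      Finsupp.finsetSum_apply, Finsupp.smul_apply, smul_eq_mul]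
    rw [Finset.sum_comm]
    refine Finset.sum_congr rfl fun j _ => ?_
    rw [Finset.mul_sum]
    exact Finset.sum_congr rfl fun k _ => by ring
  rw [e]
  exact Function.HasTemperateGrowth.sum fun j _ => Function.HasTemperateGrowth.sum fun k _ =>
    (h j).mul ((h' k).mul (Function.HasTemperateGrowth.const _))

lemma CoordTemperate.wordBracket {F F' : D → g} (h : CoordTemperate X F)
    (h' : CoordTemperate X F') (w : List Bool) :
    CoordTemperate X fun d => wordBracket w (F d) (F' d) := by
  have hl : ∀ c : Bool, CoordTemperate X fun d => cond c (F d) (F' d) := by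
    intro c; cases c <;> simpa
  induction w with
  | nil => exact CoordTemperate.zero
  | cons c w ih =>
    rcases w with _ | ⟨d, w⟩
    · exact hl c
    · exact (hl c).lie ih

lemma CoordTemperate.bch (hc : 1 ≤ LieModule.nilpotencyLength g g) {F F' : D → g}
    (h : CoordTemperate X F) (h' : CoordTemperate X F') :
    CoordTemperate X fun d => bch (F d) (F' d) := by
  have key := bch_sub_add_induction (g := g) hc
    (P := fun B => CoordTemperate X fun d => B (F d) (F' d))
    (fun w _ => h.wordBracket h' w) CoordTemperate.zero (fun B B' hB hB' => hB.add hB')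
    (fun r B hB => hB.const_smul r)
  simpa using! key.add (h.add h')

lemma CoordTemperate.incl {F : D → EuclideanSpace ℝ (Fin m)} (h : F.HasTemperateGrowth) :
    CoordTemperate X fun d => incl X (F d) := fun i => by
  refine Fin.cases ?_ (fun j => ?_) i
  · simpa only [repr_incl_zero] using Function.HasTemperateGrowth.zero
  · simp only [repr_incl_succ]
    exact (EuclideanSpace.proj (𝕜 := ℝ) j).hasTemperateGrowth.comp h

lemma CoordTemperate.proj {F : D → g} (h : CoordTemperate X F) :
    (fun d => proj X (F d)).HasTemperateGrowth := by
  have e : (fun d => Pedersen.proj X (F d)) = fun d => ∑ j : Fin m,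
      X.repr (F d) j.succ • EuclideanSpace.single j (1 : ℝ) := by
    funext d
    ext k
    simp [proj_apply, Pi.single_apply]
  rw [e]
  exact Function.HasTemperateGrowth.sum fun j _ =>
    (h j.succ).smul (Function.HasTemperateGrowth.const _)

lemma coordTemperate_bch_incl_incl (hc : 1 ≤ LieModule.nilpotencyLength g g) :
    CoordTemperate X fun z : EuclideanSpace ℝ (Fin m) × EuclideanSpace ℝ (Fin m) =>
      Pedersen.bch (Pedersen.incl X z.1) (Pedersen.incl X z.2) := by
  have h₁ : CoordTemperate X fun z : EuclideanSpace ℝ (Fin m) × EuclideanSpace ℝ (Fin m) =>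
      Pedersen.incl X z.1 := .incl (ContinuousLinearMap.fst ℝ (EuclideanSpace ℝ (Fin m))
      (EuclideanSpace ℝ (Fin m))).hasTemperateGrowth
  have h₂ : CoordTemperate X fun z : EuclideanSpace ℝ (Fin m) × EuclideanSpace ℝ (Fin m) =>
      Pedersen.incl X z.2 := .incl (ContinuousLinearMap.snd ℝ (EuclideanSpace ℝ (Fin m))
      (EuclideanSpace ℝ (Fin m))).hasTemperateGrowth
  exact h₁.bch hc h₂

lemma hasTemperateGrowth_mulE (hc : 1 ≤ LieModule.nilpotencyLength g g) :
    (fun z : EuclideanSpace ℝ (Fin m) × EuclideanSpace ℝ (Fin m) =>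
      mulE X z.1 z.2).HasTemperateGrowth :=
  (coordTemperate_bch_incl_incl hc).proj

lemma hasTemperateGrowth_alpha (hc : 1 ≤ LieModule.nilpotencyLength g g) :
    (fun z : EuclideanSpace ℝ (Fin m) × EuclideanSpace ℝ (Fin m) =>
      alpha X z.1 z.2).HasTemperateGrowth :=
  coordTemperate_bch_incl_incl hc 0

/-! ### Right translations -/

/-- This is `bch_congr` for `V = flag X (j + 1)` and `V' = flag X j`: the increment in coordinate
`j` depends only on later coordinates. -/
lemma repr_bch_sub [LieRing.IsNilpotent g] (hX : IsJordanHolder X) {x x' y y' : g}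
    (j : Fin (m + 1)) (hx : ∀ k, j < k → X.repr x k = X.repr x' k)
    (hy : ∀ k, j < k → X.repr y k = X.repr y' k) :
    X.repr (bch x y) j - (X.repr x j + X.repr y j) =
      X.repr (bch x' y') j - (X.repr x' j + X.repr y' j) := by
  have := bch_congr (one_le_nilpotencyLength X) (flag_mono (X := X) (Nat.le_succ j))
    (fun x y => lie_mem_flag hX j x) (x := x) (x' := x') (y := y) (y' := y')
    (fun k hk => by simpa [sub_eq_zero] using hx k hk)
    (fun k hk => by simpa [sub_eq_zero] using hy k hk) j le_rfl
  simpa [sub_eq_zero] using this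

lemma measurePreserving_proj_bch [LieRing.IsNilpotent g] (hX : IsJordanHolder X)
    (μ : Measure (EuclideanSpace ℝ (Fin m))) [μ.IsAddHaarMeasure] (k : g) :
    MeasurePreserving (fun x => proj X (bch (incl X x) k)) μ μ := by
  refine EuclideanSpace.measurePreserving_of_triangular ?_ fun j z z' h => ?_
  · have : CoordTemperate X fun _ : EuclideanSpace ℝ (Fin m) => k := fun i =>
      Function.HasTemperateGrowth.const _
    exact ((CoordTemperate.incl Function.HasTemperateGrowth.id).bch (one_le_nilpotencyLength X)
      this).proj.1.continuous.measurable
  · have := repr_bch_sub hX (x := incl X z) (x' := incl X z') (y := k) (y' := k) j.succ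
      (fun i hi => by
        obtain ⟨i, rfl⟩ := Fin.exists_succ_eq.2 ((Fin.succ_pos j).trans hi).ne'
        simpa only [repr_incl_succ] using h i (by simpa using hi))
      (fun _ _ => rfl)
    simp only [proj_apply, repr_incl_succ] at this ⊢
    linarith

end

end Pedersen

/-! ### Discreteness of the kernel of the representation, and associativity. -/

namespace Pedersen

section

variable {g : Type*} [LieRing g] [LieAlgebra ℝ g] [LieRing.IsNilpotent g] {m : ℕ}
  {X : Module.Basis (Fin (m + 1)) ℝ g}

/-- Associativity is not yet available, so `b` cannot be multiplied back. Instead the coordinates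
are compared from the last one down: if `a` and `b` agree beyond `j`, the increments of `a · (-b)`
and of `b · (-b) = 0` in coordinate `j` coincide, which forces agreement at `j`. -/
lemma eq_of_bch_neg_eq_zero (hX : IsJordanHolder X) {a b : g} (h : bch a (-b) = 0) : a = b := by
  have key : ∀ n : ℕ, ∀ j : Fin (m + 1), m - j.val ≤ n → X.repr a j = X.repr b j := by
    intro n
    induction n using Nat.strong_induction_on with
    | _ n ih =>
      intro j hj
      have := repr_bch_sub hX (x := a) (x' := b) (y := -b) (y' := -b) j
        (fun k hk => by
          rw [Fin.lt_def] at hk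
          exact ih (m - k) (by have := k.isLt; omega) k le_rfl)
        (fun _ _ => rfl)
      rw [h, bch_neg X] at this
      simp only [map_zero, map_neg, Finsupp.coe_zero, Finsupp.coe_neg, Pi.zero_apply, Pi.neg_apply] at this
      linarith
  rw [← X.repr.injective.eq_iff]
  ext j
  exact key _ j le_rfl

/-- Replacing `v` by `0` does not alter the coordinates beyond `j`, so by triangularity it does not
alter the increment at `j`. -/
lemma proj_bch_apply_of_top (hX : IsJordanHolder X) (x : EuclideanSpace ℝ (Fin m)) {v : g}
    {j : Fin m} (hv : ∀ k, j < k → X.repr v k.succ = 0) :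
    proj X (bch (incl X x) v) j = x j + X.repr v j.succ := by
  have := repr_bch_sub hX (x := incl X x) (x' := incl X x) (y := v) (y' := 0) j.succ
    (fun _ _ => rfl) (fun k hk => by
      obtain ⟨k, rfl⟩ := Fin.exists_succ_eq.2 ((Fin.succ_pos j).trans hk).ne'
      simpa using hv k (by simpa using hk))
  rw [bch_zero X] at this
  simp only [proj_apply, repr_incl_succ, map_zero, Finsupp.zero_apply] at this ⊢
  linarith

end

section

variable {g : Type*} [LieRing g] [LieAlgebra ℝ g] {m : ℕ} {X : Module.Basis (Fin (m + 1)) ℝ g}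
  {H : Type*} [NormedAddCommGroup H] [InnerProductSpace ℂ H] [CompleteSpace H]
  {π : g → (H →L[ℂ] H)}

namespace IsSquareIntegrableRep

lemma map_zero (hπ : IsSquareIntegrableRep X π) : π 0 = 1 := by
  simpa using hπ.central_character 0

lemma continuous_apply_incl (hπ : IsSquareIntegrableRep X π) (v : H) :
    Continuous fun x : EuclideanSpace ℝ (Fin m) => π (incl X x) v := by
  simp_rw [incl_eq_sum_cons]
  refine (hπ.continuous v).comp (continuous_pi fun i => ?_)
  refine Fin.cases ?_ (fun j => ?_) i
  · simpa using continuous_const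
  · simp only [Fin.cons_succ]; fun_prop

variable [LieRing.IsNilpotent g]

lemma map_natCast_smul (hπ : IsSquareIntegrableRep X π) {x : g} (hx : π x = 1) (n : ℕ) :
    π ((n : ℝ) • x) = 1 := by
  induction n with
  | zero => simpa using hπ.map_zero
  | succ n ih =>
    have := hπ.map_mul ((n : ℝ) • x) ((1 : ℝ) • x)
    rw [bch_smul_smul X, ih, one_smul, hx, one_mul] at this
    simpa using this

lemma map_neg (hπ : IsSquareIntegrableRep X π) {x : g} (hx : π x = 1) : π (-x) = 1 := by
  have := hπ.map_mul (-x) x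
  rw [hx, mul_one, show bch (-x) x = 0 by simpa using bch_neg X (-x), hπ.map_zero] at this
  exact this.symm

lemma map_intCast_smul (hπ : IsSquareIntegrableRep X π) {x : g} (hx : π x = 1) (n : ℤ) :
    π ((n : ℝ) • x) = 1 := by
  obtain ⟨k, rfl | rfl⟩ := n.eq_nat_or_neg
  · exact_mod_cast hπ.map_natCast_smul hx k
  · simpa using hπ.map_neg (hπ.map_natCast_smul hx k)

/-- `z` and its `g_e` part differ by a central factor, which acts by a scalar of modulus one. -/
lemma norm_inner_proj (hX : IsJordanHolder X) (hπ : IsSquareIntegrableRep X π) (v w : H) (z : g) :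
    ‖inner ℂ w (π (incl X (proj X z)) v)‖ = ‖inner ℂ w (π z v)‖ := by
  have h : bch (incl X (proj X z)) (xi0 X z • X 0) = z := by
    have := bch_add_center hX (incl X (proj X z)) 0 0 (xi0 X z)
    simpa [bch_zero X, incl_proj_add] using this
  have h2 := hπ.map_mul (incl X (proj X z)) (xi0 X z • X 0)
  rw [h, hπ.central_character] at h2
  rw [h2, mul_smul_comm, mul_one, smul_apply, inner_smul_right, norm_mul,
    mul_comm Complex.I, Complex.norm_exp_ofReal_mul_I, one_mul]

/-- Otherwise the vectors `u` with `⟨w, π(z)u⟩ = 0` for all `z` form a closed invariant subspace. It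
contains `v ≠ 0` but not `w`, against irreducibility. -/
lemma exists_inner_ne_zero (hX : IsJordanHolder X) (hπ : IsSquareIntegrableRep X π) {v w : H}
    (hv : v ≠ 0) (hw : w ≠ 0) :
    ∃ x : EuclideanSpace ℝ (Fin m), inner ℂ w (π (incl X x) v) ≠ 0 := by
  by_contra! hx
  have hz : ∀ z, inner ℂ w (π z v) = 0 := fun z => by
    rw [← norm_eq_zero, ← hπ.norm_inner_proj hX, hx, norm_zero]
  let W : Submodule ℂ H := ⨅ z, (((innerSL ℂ w).comp (π z) : H →L[ℂ] ℂ) : H →ₗ[ℂ] ℂ).ker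
  have hW : ∀ u, u ∈ W ↔ ∀ z, inner ℂ w (π z u) = 0 := fun u => by simp [W, Submodule.mem_iInf]
  have hclosed : IsClosed (W : Set H) := by
    have : (W : Set H) = ⋂ z, {u | inner ℂ w (π z u) = 0} := by ext u; simp [hW]
    rw [this]
    exact isClosed_iInter fun z => isClosed_eq (by fun_prop) continuous_const
  have hinv : ∀ x, ∀ u ∈ W, π x u ∈ W := by
    intro x u hu
    rw [hW] at hu ⊢
    intro z
    have := hu (bch z x)
    rwa [hπ.map_mul] at this
  rcases hπ.irreducible W hclosed hinv with h | h
  · have : v ∈ W := (hW v).2 hz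
    rw [h] at this
    exact hv (by simpa using this)
  · have : w ∈ W := h ▸ Submodule.mem_top
    have := (hW w).1 this 0
    rw [hπ.map_zero] at this
    exact hw (by simpa using this)

/-- The kernel of the representation contains no line. -/
lemma eq_zero_of_line (hX : IsJordanHolder X) (hπ : IsSquareIntegrableRep X π) {v : g}
    (hv : ∀ s : ℝ, π (s • v) = 1) : v = 0 := by
  by_contra hne
  by_cases hp : ∀ j : Fin m, X.repr v j.succ = 0
  · have hv0 : v = X.repr v 0 • X 0 := by
      conv_lhs => rw [← X.sum_repr v, Fin.sum_univ_succ]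
      simp [hp]
    set t := X.repr v 0
    have ht : t ≠ 0 := by rintro h; rw [h, zero_smul] at hv0; exact hne hv0
    -- The parameter is chosen so that the central character takes the value `e^{iπ} = -1`.
    have h1 := hv (Real.pi / t)
    rw [hv0, smul_smul, div_mul_cancel₀ _ ht, hπ.central_character, mul_comm,
      Complex.exp_pi_mul_I] at h1
    obtain ⟨u, hu⟩ := @exists_ne H hπ.nontrivial 0
    have h2 := congrArg (fun T : H →L[ℂ] H => T u) h1
    simp only [neg_smul, one_smul, neg_apply, one_apply_eq_self] at h2
    refine hu ((smul_eq_zero_iff_right (two_ne_zero' ℂ)).1 ?_)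
    rw [two_smul]
    nth_rw 1 [← h2]
    exact neg_add_cancel u
  · push Not at hp
    obtain ⟨j, hj, hmax⟩ : ∃ j : Fin m, X.repr v j.succ ≠ 0 ∧ ∀ k, j < k → X.repr v k.succ = 0 := by
      have hS : (Finset.univ.filter fun j : Fin m => X.repr v j.succ ≠ 0).Nonempty := by
        obtain ⟨j, hj⟩ := hp
        exact ⟨j, by simpa using hj⟩
      refine ⟨Finset.max' _ hS, (Finset.mem_filter.1 (Finset.max'_mem _ hS)).2, fun k hk => ?_⟩
      by_contra hk'
      exact absurd (Finset.le_max' _ k (Finset.mem_filter.2 ⟨Finset.mem_univ _, hk'⟩)) hk.not_ge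
    obtain ⟨a, b, ha, hb, hL⟩ := hπ.square_integrable
    obtain ⟨x₀, hx₀⟩ := hπ.exists_inner_ne_zero hX ha hb
    set F : EuclideanSpace ℝ (Fin m) → ℂ := fun x => inner ℂ b (π (incl X x) a) with hF
    have hFc : Continuous F := continuous_const.inner (hπ.continuous_apply_incl a)
    set δ : ℝ := ‖F x₀‖ / 2
    have hδ : 0 < δ := half_pos (norm_pos_iff.2 hx₀)
    -- The coefficient is larger than `δ` on `B`, and `B` lies in a slab of width one in coordinate
    -- `j`.
    set B : Set (EuclideanSpace ℝ (Fin m)) := {x | δ < ‖F x‖ ∧ |x j - x₀ j| < 1 / 2}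
    have hBo : IsOpen B := (isOpen_lt continuous_const hFc.norm).inter
      (isOpen_lt (f := fun x : EuclideanSpace ℝ (Fin m) => |x j - x₀ j|) (by fun_prop)
        continuous_const)
    have hBpos : volume B ≠ 0 := (hBo.measure_pos volume
      ⟨x₀, half_lt_self (norm_pos_iff.2 hx₀), by norm_num⟩).ne'
    -- Right translation by a multiple of `v` preserves the measure and the modulus of the
    -- coefficient, and shifts coordinate `j` by exactly `n`. The preimages of `B` are therefore
    -- disjoint and of equal positive measure, while square-integrability allows only finite measure
    -- for the set where the coefficient is at least `δ`.
    set T : ℕ → EuclideanSpace ℝ (Fin m) → EuclideanSpace ℝ (Fin m) := fun n x =>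
      proj X (bch (incl X x) (((n : ℝ) / X.repr v j.succ) • v))
    have hT : ∀ n, MeasurePreserving (T n) volume volume := fun n =>
      measurePreserving_proj_bch hX volume _
    have hTF : ∀ n x, ‖F (T n x)‖ = ‖F x‖ := fun n x => by
      simp only [hF, T]
      rw [hπ.norm_inner_proj hX, hπ.map_mul, hv, mul_one]
    have hTj : ∀ n x, T n x j = x j + n := fun n x => by
      have := proj_bch_apply_of_top hX x (v := ((n : ℝ) / X.repr v j.succ) • v) (j := j)
        (fun k hk => by simp [hmax k hk])
      simp only [T]
      rw [this]
      simp [hj]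
    have hdisj : Pairwise (Function.onFun Disjoint fun n => T n ⁻¹' B) := by
      intro n k hnk
      refine Set.disjoint_left.2 fun x hx hx' => hnk ?_
      have h1 := hx.2
      have h2 := hx'.2
      rw [hTj] at h1 h2
      rw [abs_lt] at h1 h2
      have h3 : (n : ℝ) < k + 1 := by linarith
      have h4 : (k : ℝ) < n + 1 := by linarith
      norm_cast at h3 h4
      omega
    have hU : volume (⋃ n, T n ⁻¹' B) = ⊤ := by
      rw [measure_iUnion hdisj fun n => (hT n).measurable hBo.measurableSet]
      simp_rw [fun n => (hT n).measure_preimage hBo.measurableSet.nullMeasurableSet]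
      exact ENNReal.tsum_const_eq_top_of_ne_zero hBpos
    have hfin := hL.meas_ge_lt_top (by norm_num) (by norm_num)
      (ε := ⟨δ, hδ.le⟩) (fun h => hδ.ne' (congrArg NNReal.toReal h))
    refine absurd hU (ne_top_of_le_ne_top hfin.ne (measure_mono ?_))
    intro x hx
    obtain ⟨n, hn⟩ := Set.mem_iUnion.1 hx
    have := hn.1
    rw [hTF] at this
    exact this.le

/-- The kernel of the representation is discrete. -/
lemma exists_ball_kernel (hX : IsJordanHolder X) (hπ : IsSquareIntegrableRep X π) :
    ∃ δ > 0, ∀ c : Fin (m + 1) → ℝ, ‖c‖ < δ → π (∑ j, c j • X j) = 1 → c = 0 := by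
  by_contra! hcon
  choose c hc hc1 hc0 using fun n : ℕ => hcon (1 / ((n : ℝ) + 1)) Nat.one_div_pos_of_nat
  have hcpos : ∀ n, 0 < ‖c n‖ := fun n => norm_pos_iff.2 (hc0 n)
  have hclim : Filter.Tendsto (fun n => ‖c n‖) Filter.atTop (nhds 0) :=
    squeeze_zero (fun n => norm_nonneg _) (fun n => (hc n).le) tendsto_one_div_add_atTop_nhds_zero_nat
  have hu : ∀ n, ‖c n‖⁻¹ • c n ∈ Metric.sphere (0 : Fin (m + 1) → ℝ) 1 := fun n => by
    rw [mem_sphere_zero_iff_norm, norm_smul, norm_inv, norm_norm, inv_mul_cancel₀ (hcpos n).ne']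
  obtain ⟨v, hv, φ, hφ, hlim⟩ := (isCompact_sphere (0 : Fin (m + 1) → ℝ) 1).tendsto_subseq hu
  have hline : ∀ s : ℝ, π (s • ∑ j, v j • X j) = 1 := by
    intro s
    -- Integer multiples of the small kernel elements follow the limiting direction: rounding `s /
    -- ‖c‖` down costs at most `‖c‖`. The kernel thus contains the whole line through `v`.
    have hk : Filter.Tendsto (fun n => ((⌊s / ‖c (φ n)‖⌋ : ℤ) : ℝ) • c (φ n)) Filter.atTop
        (nhds (s • v)) := by
      have h1 := hlim.const_smul s
      have h2 : Filter.Tendsto (fun n => ((⌊s / ‖c (φ n)‖⌋ : ℤ) : ℝ) • c (φ n) -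
          s • (‖c (φ n)‖⁻¹ • c (φ n))) Filter.atTop (nhds 0) := by
        refine squeeze_zero_norm (fun n => ?_) (hclim.comp hφ.tendsto_atTop)
        rw [smul_smul, ← sub_smul, norm_smul, ← div_eq_mul_inv, Function.comp_apply]
        refine mul_le_of_le_one_left (norm_nonneg _) ?_
        rw [Real.norm_eq_abs, abs_le]
        have := Int.floor_le (s / ‖c (φ n)‖)
        have := Int.lt_floor_add_one (s / ‖c (φ n)‖)
        constructor <;> linarith
      simpa using h2.add h1
    ext w
    have hcont := ((hπ.continuous w).tendsto (s • v)).comp hk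
    have hconst : ∀ n, π (∑ j, (((⌊s / ‖c (φ n)‖⌋ : ℤ) : ℝ) • c (φ n)) j • X j) w = w := fun n => by
      have := hπ.map_intCast_smul (hc1 (φ n)) ⌊s / ‖c (φ n)‖⌋
      simp only [Finset.smul_sum, smul_smul] at this
      simp only [Pi.smul_apply, smul_eq_mul, this]
      rfl
    have h3 := tendsto_nhds_unique hcont
      (tendsto_const_nhds.congr fun n => (hconst n).symm)
    simpa [Finset.smul_sum, smul_smul] using h3
  have hv0 := hπ.eq_zero_of_line hX hline
  have hvz : v = 0 := by
    rwa [← X.equivFun_symm_apply, LinearEquiv.map_eq_zero_iff] at hv0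
  rw [hvz] at hv
  simp at hv

/-- The Baker-Campbell-Hausdorff product is associative. -/
theorem bch_assoc (hX : IsJordanHolder X) (hπ : IsSquareIntegrableRep X π) (x y z : g) :
    bch (bch x y) z = bch x (bch y z) := by
  obtain ⟨δ, hδ, hker⟩ := hπ.exists_ball_kernel hX
  have hc := one_le_nilpotencyLength X
  let V := Fin (m + 1) → ℝ
  let D := V × V × V
  let e : V → g := X.equivFun.symm
  have he : ∀ u, X.equivFun.symm (X.equivFun u) = u := X.equivFun.symm_apply_apply
  have hcoord : ∀ L : D →L[ℝ] V, CoordTemperate X fun d => e (L d) := fun L i => by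
    have : (fun d => X.repr (e (L d)) i) = (ContinuousLinearMap.proj (R := ℝ) i).comp L := by
      funext d
      exact congrFun (X.equivFun.apply_symm_apply (L d)) i
    rw [this]
    exact ContinuousLinearMap.hasTemperateGrowth _
  have hx := hcoord (ContinuousLinearMap.fst ℝ V (V × V))
  have hy := hcoord ((ContinuousLinearMap.fst ℝ V V).comp (ContinuousLinearMap.snd ℝ V (V × V)))
  have hz := hcoord ((ContinuousLinearMap.snd ℝ V V).comp (ContinuousLinearMap.snd ℝ V (V × V)))
  let a : D → g := fun d => bch (bch (e d.1) (e d.2.1)) (e d.2.2)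
  let b : D → g := fun d => bch (e d.1) (bch (e d.2.1) (e d.2.2))
  have ha : CoordTemperate X a := (hx.bch hc hy).bch hc hz
  have hb : CoordTemperate X b := hx.bch hc (hy.bch hc hz)
  have hnb : CoordTemperate X fun d => -b d := by simpa using hb.const_smul (-1)
  have hcc := ha.bch hc hnb
  have hcont : Continuous fun d => X.equivFun (bch (a d) (-b d)) :=
    continuous_pi fun i => (hcc i).1.continuous
  -- Operator multiplication is associative, so `π` cannot distinguish `a` from `b`.
  have hone : ∀ d, π (bch (a d) (-b d)) = 1 := fun d => by
    have hab : π (a d) = π (b d) := by simp only [a, b, hπ.map_mul, mul_assoc]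
    rw [hπ.map_mul, hab, ← hπ.map_mul, bch_neg X, hπ.map_zero]
  have hS : {d | a d = b d} = Set.univ := by
    refine IsClopen.eq_univ ⟨?_, ?_⟩ ⟨0, ?_⟩
    · have : {d | a d = b d} = {d | X.equivFun (a d) = X.equivFun (b d)} := by
        ext d; simp
      rw [this]
      exact isClosed_eq (continuous_pi fun i => (ha i).1.continuous)
        (continuous_pi fun i => (hb i).1.continuous)
    · rw [isOpen_iff_mem_nhds]
      intro d hd
      have h0 : X.equivFun (bch (a d) (-b d)) = 0 := by
        rw [show a d = b d from hd, bch_neg X, _root_.map_zero]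
      -- Near a point of agreement, `a · (-b)` is a kernel element inside the ball of
      -- `exists_ball_kernel`, hence zero.
      have hnear : ∀ᶠ d' in nhds d, ‖X.equivFun (bch (a d') (-b d'))‖ < δ := by
        refine (hcont.norm.tendsto d).eventually_lt_const ?_
        rw [h0, norm_zero]
        exact hδ
      filter_upwards [hnear] with d' hd'
      have hz := hker _ hd' (by
        rw [← X.equivFun_symm_apply, he, hone])
      rw [LinearEquiv.map_eq_zero_iff] at hz
      exact eq_of_bch_neg_eq_zero hX hz
    · have he0 : e 0 = 0 := _root_.map_zero X.equivFun.symm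
      change bch (bch (e 0) (e 0)) (e 0) = bch (e 0) (bch (e 0) (e 0))
      simp only [he0, bch_zero X]
  have := Set.eq_univ_iff_forall.1 hS (X.equivFun x, X.equivFun y, X.equivFun z)
  simpa only [a, b, e, Set.mem_ofPred_eq, he] using this

end IsSquareIntegrableRep

end

end Pedersen

/-! ### Groups with a cocycle, abstracted from `g_e`. -/

/-- A Lie group structure `M` on a vector space `E`, with unit `0` and inverse `-x`, and a real
cocycle `A` for it, both smooth of temperate growth, for which right translations preserve the
measure `μ`. -/
structure IsTwistedGroup {E : Type*} [NormedAddCommGroup E] [NormedSpace ℝ E] [MeasurableSpace E]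
    (M : E → E → E) (A : E → E → ℝ) (μ : Measure E) : Prop where
  growth_mul : (fun z : E × E => M z.1 z.2).HasTemperateGrowth
  growth_cocycle : (fun z : E × E => A z.1 z.2).HasTemperateGrowth
  assoc : ∀ x y z, M (M x y) z = M x (M y z)
  cocycle : ∀ x y z, A (M x y) z + A x y = A x (M y z) + A y z
  mul_zero : ∀ x, M x 0 = x
  zero_mul : ∀ x, M 0 x = x
  mul_neg : ∀ x, M x (-x) = 0
  cocycle_zero_right : ∀ x, A x 0 = 0
  cocycle_zero_left : ∀ x, A 0 x = 0
  cocycle_neg : ∀ x, A x (-x) = 0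
  measurePreserving : ∀ a, MeasurePreserving (fun x => M x a) μ μ

namespace Pedersen

section

variable {g : Type*} [LieRing g] [LieAlgebra ℝ g] [LieRing.IsNilpotent g] {m : ℕ}
  {X : Module.Basis (Fin (m + 1)) ℝ g}
  {H : Type*} [NormedAddCommGroup H] [InnerProductSpace ℂ H] [CompleteSpace H]
  {π : g → (H →L[ℂ] H)}

/-- In the associativity of `bch`, the `g_e` component gives the group law and the `X₁` component
gives the cocycle identity. -/
theorem IsSquareIntegrableRep.isTwistedGroup (hX : IsJordanHolder X)
    (hπ : IsSquareIntegrableRep X π) (μ : Measure (EuclideanSpace ℝ (Fin m)))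
    [μ.IsAddHaarMeasure] : IsTwistedGroup (mulE X) (alpha X) μ := by
  have hc := one_le_nilpotencyLength X
  have hl : ∀ x y z : EuclideanSpace ℝ (Fin m), bch (bch (incl X x) (incl X y)) (incl X z) =
      incl X (mulE X (mulE X x y) z) + (alpha X (mulE X x y) z + alpha X x y) • X 0 := by
    intro x y z
    have := bch_add_center hX (incl X (mulE X x y)) (incl X z) (alpha X x y) 0
    rw [zero_smul, add_zero, add_zero] at this
    rw [bch_incl_incl, this, bch_incl_incl, add_smul, add_assoc]
  have hr : ∀ x y z : EuclideanSpace ℝ (Fin m), bch (incl X x) (bch (incl X y) (incl X z)) =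
      incl X (mulE X x (mulE X y z)) + (alpha X x (mulE X y z) + alpha X y z) • X 0 := by
    intro x y z
    have := bch_add_center hX (incl X x) (incl X (mulE X y z)) 0 (alpha X y z)
    rw [zero_smul, add_zero, zero_add] at this
    rw [bch_incl_incl y z, this, bch_incl_incl, add_smul, add_assoc]
  have hlr := fun x y z => (hl x y z).symm.trans ((hπ.bch_assoc hX _ _ _).trans (hr x y z))
  have hz : ∀ x : EuclideanSpace ℝ (Fin m), mulE X x 0 = x ∧ alpha X x 0 = 0 := fun x =>
    mulE_eq_of_bch_eq (by rw [incl_zero, bch_zero X, zero_smul, add_zero])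
  have hz' : ∀ x : EuclideanSpace ℝ (Fin m), mulE X 0 x = x ∧ alpha X 0 x = 0 := fun x =>
    mulE_eq_of_bch_eq (by rw [incl_zero, zero_bch X, zero_smul, add_zero])
  have hn : ∀ x : EuclideanSpace ℝ (Fin m), mulE X x (-x) = 0 ∧ alpha X x (-x) = 0 := fun x =>
    mulE_eq_of_bch_eq (by rw [incl_neg, bch_neg X, incl_zero, zero_smul, add_zero])
  exact
    { growth_mul := hasTemperateGrowth_mulE hc
      growth_cocycle := hasTemperateGrowth_alpha hc
      assoc := fun x y z => by
        have := congrArg (proj X) (hlr x y z)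
        rwa [proj_incl_add, proj_incl_add] at this
      cocycle := fun x y z => by
        have := congrArg (xi0 X) (hlr x y z)
        rwa [xi0_incl_add, xi0_incl_add] at this
      mul_zero := fun x => (hz x).1
      zero_mul := fun x => (hz' x).1
      mul_neg := fun x => (hn x).1
      cocycle_zero_right := fun x => (hz x).2
      cocycle_zero_left := fun x => (hz' x).2
      cocycle_neg := fun x => (hn x).2
      measurePreserving := fun a => measurePreserving_proj_bch hX μ (incl X a) }

end

end Pedersen

namespace IsTwistedGroup

variable {E : Type*} [NormedAddCommGroup E] [NormedSpace ℝ E] [MeasurableSpace E]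
  {M : E → E → E} {A : E → E → ℝ} {μ : Measure E}

lemma neg_mul (h : IsTwistedGroup M A μ) (x : E) : M (-x) x = 0 := by
  simpa using h.mul_neg (-x)

lemma cocycle_neg' (h : IsTwistedGroup M A μ) (x : E) : A (-x) x = 0 := by
  simpa using h.cocycle_neg (-x)

lemma mul_mul_neg (h : IsTwistedGroup M A μ) (x y : E) : M (M x y) (-y) = x := by
  rw [h.assoc, h.mul_neg, h.mul_zero]

lemma mul_neg_mul (h : IsTwistedGroup M A μ) (x y : E) : M (M x (-y)) y = x := by
  rw [h.assoc, h.neg_mul, h.mul_zero]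

lemma mul_neg_mul_self (h : IsTwistedGroup M A μ) (x y : E) : M x (M (-x) y) = y := by
  rw [← h.assoc, h.mul_neg, h.zero_mul]

lemma neg_mul_mul_self (h : IsTwistedGroup M A μ) (x y : E) : M (-x) (M x y) = y := by
  rw [← h.assoc, h.neg_mul, h.zero_mul]

lemma mul_neg_neg (h : IsTwistedGroup M A μ) (x y : E) : M (-y) (-x) = -M x y := by
  have h1 : M (M x y) (M (-y) (-x)) = 0 := by
    rw [h.assoc, h.mul_neg_mul_self, h.mul_neg]
  rw [← h.neg_mul_mul_self (M x y) (M (-y) (-x)), h1, h.mul_zero]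

/-- Turns the phase in the definition of twisted convolution into the phase of the translation by
`-y`. -/
lemma cocycle_mul_neg (h : IsTwistedGroup M A μ) (x y : E) : A (M x (-y)) y = -A x (-y) := by
  have := h.cocycle x (-y) y
  rw [h.neg_mul, h.cocycle_zero_right, h.cocycle_neg'] at this
  linarith

lemma cocycle_neg_neg (h : IsTwistedGroup M A μ) (x y : E) : A (-y) (-x) = -A x y := by
  have h1 := h.cocycle x y (M (-y) (-x))
  have h2 := h.cocycle y (-y) (-x)
  rw [h.mul_neg_mul_self, h.cocycle_neg, h.mul_neg_neg, h.cocycle_neg] at h1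
  rw [h.mul_neg, h.cocycle_zero_left, h.cocycle_neg, h.mul_neg_neg] at h2
  linarith

end IsTwistedGroup

/-! ### Functions of temperate growth. -/

namespace Function.HasTemperateGrowth

open scoped ContDiff

lemma cexp_I_mul : (fun t : ℝ => Complex.exp (Complex.I * t)).HasTemperateGrowth := by
  have hd : ∀ n : ℕ, iteratedDeriv n (fun t : ℝ => Complex.exp (Complex.I * t)) =
      fun t : ℝ => Complex.I ^ n * Complex.exp (Complex.I * t) := by
    intro n
    induction n with
    | zero => simp
    | succ n ih =>
      rw [iteratedDeriv_succ, ih]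
      funext t
      have h1 : HasDerivAt (fun t : ℝ => Complex.I * (t : ℂ)) (Complex.I * 1) t :=
        Complex.ofRealCLM.hasDerivAt.const_mul Complex.I
      rw [(h1.cexp.const_mul (Complex.I ^ n)).deriv]
      ring
  refine ⟨(contDiff_const.mul Complex.ofRealCLM.contDiff).cexp, fun n => ⟨0, 1, fun t => ?_⟩⟩
  rw [norm_iteratedFDeriv_eq_norm_iteratedDeriv, hd, norm_mul, norm_pow, Complex.norm_I,
    mul_comm Complex.I, Complex.norm_exp_ofReal_mul_I]
  simp

variable {E F : Type*} [NormedAddCommGroup E] [NormedSpace ℝ E] [NormedAddCommGroup F]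
  [NormedSpace ℝ F]

lemma fderiv {f : E → F} (hf : f.HasTemperateGrowth) : (fderiv ℝ f).HasTemperateGrowth := by
  refine ⟨hf.1.fderiv_right (by simp), fun n => ?_⟩
  obtain ⟨k, C, h⟩ := hf.2 (n + 1)
  exact ⟨k, C, fun x => by rw [norm_iteratedFDeriv_fderiv]; exact h x⟩

lemma prodMk_const (a : F) : (fun x : E => (x, a)).HasTemperateGrowth := by
  have h1 := (ContinuousLinearMap.inl ℝ E F).hasTemperateGrowth.add
    (Function.HasTemperateGrowth.const (E := E) ((0 : E), a))
  refine (congrArg Function.HasTemperateGrowth (funext fun x => ?_)).mp h1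
  simp

lemma prodMk {G : Type*} [NormedAddCommGroup G] [NormedSpace ℝ G] {f : G → E} {f' : G → F}
    (h : f.HasTemperateGrowth) (h' : f'.HasTemperateGrowth) :
    (fun x => (f x, f' x)).HasTemperateGrowth := by
  have h1 := ((ContinuousLinearMap.inl ℝ E F).hasTemperateGrowth.comp h).add
    ((ContinuousLinearMap.inr ℝ E F).hasTemperateGrowth.comp h')
  refine (congrArg Function.HasTemperateGrowth (funext fun x => ?_)).mp h1
  simp

lemma exists_norm_le {f : E → F} (hf : f.HasTemperateGrowth) :
    ∃ (k : ℕ) (C : ℝ), ∀ x, ‖f x‖ ≤ C * (1 + ‖x‖) ^ k := by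
  obtain ⟨k, C, h⟩ := hf.2 0
  exact ⟨k, C, fun x => by simpa using h x⟩

end Function.HasTemperateGrowth

/-! ### Tensor products and slices of Schwartz functions. -/

namespace SchwartzMap

open scoped ContDiff

variable {E F : Type*} [NormedAddCommGroup E] [NormedSpace ℝ E] [NormedAddCommGroup F]
  [NormedSpace ℝ F]

/-- The function `(x, a) ↦ φ x * χ a`. -/
noncomputable def tensor (φ : 𝓢(E, ℂ)) (χ : 𝓢(F, ℂ)) : 𝓢(E × F, ℂ) where
  toFun z := φ z.1 * χ z.2
  smooth' := ((φ.smooth ⊤).comp contDiff_fst).mul ((χ.smooth ⊤).comp contDiff_snd)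
  decay' k n := by
    -- The bound is Leibniz's rule combined with `‖z‖^k ≤ ‖z.1‖^k + ‖z.2‖^k`; each power of the norm
    -- is absorbed by one factor.
    refine ⟨∑ i ∈ Finset.range (n + 1), (n.choose i : ℝ) *
      (SchwartzMap.seminorm ℝ k i φ * SchwartzMap.seminorm ℝ 0 (n - i) χ +
        SchwartzMap.seminorm ℝ 0 i φ * SchwartzMap.seminorm ℝ k (n - i) χ), fun z => ?_⟩
    have h1 := norm_iteratedFDeriv_mul_le (𝕜 := ℝ) (f := fun z : E × F => φ z.1)
      (g := fun z : E × F => χ z.2) (N := ∞) ((φ.smooth ⊤).comp contDiff_fst)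
      ((χ.smooth ⊤).comp contDiff_snd) z (n := n) (mod_cast le_top)
    refine (mul_le_mul_of_nonneg_left h1 (by positivity)).trans ?_
    rw [Finset.mul_sum]
    refine Finset.sum_le_sum fun i _ => ?_
    have hφ : ‖iteratedFDeriv ℝ i (fun z : E × F => φ z.1) z‖ ≤ ‖iteratedFDeriv ℝ i φ z.1‖ := by
      have := ContinuousLinearMap.iteratedFDeriv_comp_right (ContinuousLinearMap.fst ℝ E F)
        (φ.smooth ⊤) z (i := i) (mod_cast le_top)
      change ‖iteratedFDeriv ℝ i (φ ∘ (ContinuousLinearMap.fst ℝ E F)) z‖ ≤ _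
      rw [this]
      refine (ContinuousMultilinearMap.norm_compContinuousLinearMap_le _ _).trans ?_
      refine mul_le_of_le_one_right (norm_nonneg _) (Finset.prod_le_one (fun _ _ => norm_nonneg _)
        fun _ _ => ContinuousLinearMap.norm_fst_le ..)
    have hχ : ‖iteratedFDeriv ℝ (n - i) (fun z : E × F => χ z.2) z‖ ≤
        ‖iteratedFDeriv ℝ (n - i) χ z.2‖ := by
      have := ContinuousLinearMap.iteratedFDeriv_comp_right (ContinuousLinearMap.snd ℝ E F)
        (χ.smooth ⊤) z (i := n - i)
        (WithTop.coe_le_coe.2 le_top)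
      change ‖iteratedFDeriv ℝ (n - i) (χ ∘ (ContinuousLinearMap.snd ℝ E F)) z‖ ≤ _
      rw [this]
      refine (ContinuousMultilinearMap.norm_compContinuousLinearMap_le _ _).trans ?_
      refine mul_le_of_le_one_right (norm_nonneg _) (Finset.prod_le_one (fun _ _ => norm_nonneg _)
        fun _ _ => ContinuousLinearMap.norm_snd_le ..)
    have hz : ‖z‖ ^ k ≤ ‖z.1‖ ^ k + ‖z.2‖ ^ k := by
      rw [Prod.norm_def]
      rcases max_cases ‖z.1‖ ‖z.2‖ with ⟨h, _⟩ | ⟨h, _⟩ <;> rw [h]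
      · linarith [pow_nonneg (norm_nonneg z.2) k]
      · linarith [pow_nonneg (norm_nonneg z.1) k]
    have a1 := φ.le_seminorm ℝ k i z.1
    have a2 := φ.norm_iteratedFDeriv_le_seminorm ℝ i z.1
    have a3 := χ.le_seminorm ℝ k (n - i) z.2
    have a4 := χ.norm_iteratedFDeriv_le_seminorm ℝ (n - i) z.2
    calc ‖z‖ ^ k * ((n.choose i : ℝ) * ‖iteratedFDeriv ℝ i (fun z : E × F => φ z.1) z‖ *
          ‖iteratedFDeriv ℝ (n - i) (fun z : E × F => χ z.2) z‖)
        ≤ (‖z.1‖ ^ k + ‖z.2‖ ^ k) * ((n.choose i : ℝ) * ‖iteratedFDeriv ℝ i φ z.1‖ *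
          ‖iteratedFDeriv ℝ (n - i) χ z.2‖) := by gcongr
      _ = (n.choose i : ℝ) * ((‖z.1‖ ^ k * ‖iteratedFDeriv ℝ i φ z.1‖) *
          ‖iteratedFDeriv ℝ (n - i) χ z.2‖ + ‖iteratedFDeriv ℝ i φ z.1‖ *
          (‖z.2‖ ^ k * ‖iteratedFDeriv ℝ (n - i) χ z.2‖)) := by ring
      _ ≤ _ := by gcongr

@[simp]
lemma tensor_apply (φ : 𝓢(E, ℂ)) (χ : 𝓢(F, ℂ)) (z : E × F) : tensor φ χ z = φ z.1 * χ z.2 := rfl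

/-- The restriction of a Schwartz function on `E × F` to `E × {a}`. -/
noncomputable def slice (Ψ : 𝓢(E × F, ℂ)) (a : F) : 𝓢(E, ℂ) :=
  compCLM ℂ (Function.HasTemperateGrowth.prodMk_const a)
    ⟨1, 1, fun x => by
      have : ‖x‖ ≤ ‖(x, a)‖ := norm_fst_le (x, a)
      linarith⟩ Ψ

@[simp]
lemma slice_apply (Ψ : 𝓢(E × F, ℂ)) (a : F) (x : E) : slice Ψ a x = Ψ (x, a) := rfl

/-- The mean value inequality for the `n`-th derivative along the segment from `(x, b)` to `(x, a)`,
on which the weight `‖x‖^k` is constant and at most `‖z‖^k`. -/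
lemma seminorm_slice_sub_le (Ψ : 𝓢(E × F, ℂ)) (k n : ℕ) (a b : F) :
    SchwartzMap.seminorm ℂ k n (slice Ψ a - slice Ψ b) ≤
      SchwartzMap.seminorm ℂ k (n + 1) Ψ * ‖a - b‖ := by
  refine seminorm_le_bound ℂ k n _ (by positivity) fun x => ?_
  have hcomp : ⇑(slice Ψ a - slice Ψ b) = (fun z => Ψ (z + (0, a)) - Ψ (z + (0, b))) ∘
      ContinuousLinearMap.inl ℝ E F := by
    funext x
    simp
  have hs : ∀ c : E × F, ContDiff ℝ ∞ fun z => Ψ (z + c) := fun c =>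
    (Ψ.smooth ⊤).comp (by fun_prop)
  have hG : ContDiff ℝ ∞ fun z => Ψ (z + (0, a)) - Ψ (z + (0, b)) := (hs _).sub (hs _)
  rw [hcomp, ContinuousLinearMap.iteratedFDeriv_comp_right _ hG x (mod_cast le_top)]
  have h1 : ‖(iteratedFDeriv ℝ n (fun z => Ψ (z + (0, a)) - Ψ (z + (0, b)))
      (ContinuousLinearMap.inl ℝ E F x)).compContinuousLinearMap
        fun _ => ContinuousLinearMap.inl ℝ E F‖ ≤
      ‖iteratedFDeriv ℝ n Ψ (x, a) - iteratedFDeriv ℝ n Ψ (x, b)‖ := by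
    refine (ContinuousMultilinearMap.norm_compContinuousLinearMap_le _ _).trans ?_
    refine (mul_le_of_le_one_right (norm_nonneg _) (Finset.prod_le_one (fun _ _ => norm_nonneg _)
        fun _ _ => ContinuousLinearMap.norm_inl_le_one ..)).trans_eq ?_
    have hsub := iteratedFDeriv_sub_apply (𝕜 := ℝ) (i := n) (x := ContinuousLinearMap.inl ℝ E F x)
      ((hs (0, a)).contDiffAt.of_le (mod_cast le_top))
      ((hs (0, b)).contDiffAt.of_le (mod_cast le_top))
    have e : (fun z => Ψ (z + (0, a)) - Ψ (z + (0, b))) =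
      (fun z => Ψ (z + (0, a))) - fun z => Ψ (z + (0, b)) := rfl
    rw [e, hsub, iteratedFDeriv_comp_add_right, iteratedFDeriv_comp_add_right]
    simp
  refine (mul_le_mul_of_nonneg_left h1 (by positivity)).trans ?_
  have hconv : Convex ℝ {z : E × F | z.1 = x} :=
    (convex_singleton x).affine_preimage (LinearMap.fst ℝ E F).toAffineMap
  have hd : Differentiable ℝ (iteratedFDeriv ℝ n Ψ) :=
    (Ψ.smooth ⊤).differentiable_iteratedFDeriv (mod_cast ENat.natCast_lt_top n)
  have hmv := hconv.norm_image_sub_le_of_norm_fderiv_le (𝕜 := ℝ)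
    (f := fun z => (‖x‖ ^ k) • iteratedFDeriv ℝ n Ψ z) (x := (x, b)) (y := (x, a))
    (C := SchwartzMap.seminorm ℂ k (n + 1) Ψ)
    (fun z _ => (hd z).const_smul (‖x‖ ^ k)) (fun z hz => by
      have hz' : z.1 = x := hz
      have hfd : fderiv ℝ (fun z => (‖x‖ ^ k) • iteratedFDeriv ℝ n Ψ z) z = _ :=
        ((hd z).hasFDerivAt.const_smul (‖x‖ ^ k)).fderiv
      rw [hfd, norm_smul, norm_pow, norm_norm, norm_fderiv_iteratedFDeriv]
      refine le_trans ?_ (Ψ.le_seminorm ℂ k (n + 1) z)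
      gcongr
      rw [← hz']
      exact norm_fst_le z) rfl rfl
  rw [← smul_sub, norm_smul, norm_pow, norm_norm] at hmv
  refine hmv.trans_eq ?_
  congr 1
  simp [Prod.norm_def]

lemma continuous_slice (Ψ : 𝓢(E × F, ℂ)) : Continuous (slice Ψ) := by
  rw [continuous_iff_continuousAt]
  intro b
  refine ((schwartz_withSeminorms ℂ E ℂ).tendsto_nhds _ _).2 fun i ε hε => ?_
  have h : Filter.Tendsto (fun a => SchwartzMap.seminorm ℂ i.1 (i.2 + 1) Ψ * ‖a - b‖) (nhds b)
      (nhds (SchwartzMap.seminorm ℂ i.1 (i.2 + 1) Ψ * ‖b - b‖)) :=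
    (Continuous.tendsto (by fun_prop) b)
  rw [sub_self, norm_zero, mul_zero] at h
  filter_upwards [h.eventually_lt_const hε] with a ha
  exact (seminorm_slice_sub_le Ψ i.1 i.2 a b).trans_lt ha

end SchwartzMap

/-! ### Evaluation at the origin through powers of the Laplacian. -/

namespace SchwartzMap

open scoped FourierTransform Laplacian LineDeriv
open Laplacian

variable {E : Type*} [NormedAddCommGroup E] [InnerProductSpace ℝ E] [FiniteDimensional ℝ E]
  [MeasurableSpace E] [BorelSpace E]

/-- The operator `1 - (2π)⁻² Δ`, whose Fourier symbol is `1 + ‖ξ‖²`. -/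
noncomputable def oneSubLaplacian (f : 𝓢(E, ℂ)) : 𝓢(E, ℂ) := f - ((2 * Real.pi) ^ 2)⁻¹ • Δ f

lemma fourier_oneSubLaplacian (f : 𝓢(E, ℂ)) (ξ : E) :
    𝓕 (oneSubLaplacian f) ξ = ((1 + ‖ξ‖ ^ 2 : ℝ) : ℂ) * 𝓕 f ξ := by
  have hpi : (2 * Real.pi) ^ 2 ≠ 0 := by positivity
  have h : oneSubLaplacian f = f + fourierMultiplierCLM ℂ (fun x : E => ‖x‖ ^ 2) f := by
    rw [oneSubLaplacian, laplacian_eq_fourierMultiplierCLM, smul_smul, mul_neg,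
      inv_mul_cancel₀ hpi, neg_one_smul, sub_neg_eq_add]
  rw [h, FourierTransform.fourier_add, fourierMultiplierCLM_apply,
    FourierTransform.fourier_fourierInv_eq, add_apply,
    smulLeftCLM_apply_apply (Function.hasTemperateGrowth_norm_sq E)]
  rw [Complex.real_smul]
  push_cast
  ring

lemma fourier_oneSubLaplacian_iterate (N : ℕ) (f : 𝓢(E, ℂ)) (ξ : E) :
    𝓕 (oneSubLaplacian^[N] f) ξ = ((1 + ‖ξ‖ ^ 2 : ℝ) : ℂ) ^ N * 𝓕 f ξ := by
  induction N with
  | zero => simp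
  | succ N ih =>
    rw [Function.iterate_succ_apply', fourier_oneSubLaplacian, ih, pow_succ]
    ring

/-- The value at the origin is the integral of a high power of `1 - (2π)⁻² Δ` against a continuous
function. -/
theorem exists_apply_zero_eq_integral : ∃ (N : ℕ) (w : E → ℂ), Continuous w ∧
    ∀ f : 𝓢(E, ℂ), f 0 = ∫ y, w y * (oneSubLaplacian^[N] f) y := by
  -- With this `N` one has `2N > dim E`, so `W = (1 + ‖ξ‖²)^{-N}` is integrable. Since `f 0 = ∫ 𝓕
  -- f`, moving the Fourier transform onto `W` gives the formula with `w = 𝓕 W`.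
  set N := Module.finrank ℝ E + 1
  set W : E → ℂ := fun ξ => ((((1 + ‖ξ‖ ^ 2 : ℝ) ^ N)⁻¹ : ℝ) : ℂ)
  have hW : Integrable W := by
    have h := integrable_rpow_neg_one_add_norm_sq (E := E) (μ := volume) (r := 2 * N)
      (by simp only [N]; push_cast; linarith [Nat.cast_nonneg (α := ℝ) (Module.finrank ℝ E)])
    have h' : Integrable (fun ξ : E => ((1 + ‖ξ‖ ^ 2) ^ N)⁻¹) := by
      refine h.congr (Filter.Eventually.of_forall fun ξ => ?_)
      have : (0 : ℝ) ≤ 1 + ‖ξ‖ ^ 2 := by positivity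
      simp only
      rw [show -(2 * (N : ℝ)) / 2 = -(N : ℝ) by ring, Real.rpow_neg this, Real.rpow_natCast]
    exact h'.ofReal
  refine ⟨N, 𝓕 W, ?_, fun f => ?_⟩
  · exact VectorFourier.fourierIntegral_continuous Real.continuous_fourierChar
      (by exact continuous_inner) hW
  · have h1 : f 0 = ∫ ξ, 𝓕 f ξ := by
      have h0 : 𝓕⁻ (𝓕 f) = f := FourierTransform.fourierInv_fourier_eq f
      rw [← h0, fourierInv_coe, Real.fourierInv_eq', h0]
      simp
    have h2 : ∀ ξ, 𝓕 f ξ = W ξ * 𝓕 (oneSubLaplacian^[N] f) ξ := fun ξ => by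
      have hne : ((1 + ‖ξ‖ ^ 2 : ℝ) : ℂ) ^ N ≠ 0 := by
        have : (0 : ℝ) < 1 + ‖ξ‖ ^ 2 := by positivity
        exact pow_ne_zero _ (by exact_mod_cast this.ne')
      rw [fourier_oneSubLaplacian_iterate]
      simp only [W]
      push_cast at hne ⊢
      rw [inv_mul_cancel_left₀ hne]
    have h3 := VectorFourier.integral_fourierIntegral_smul_eq_flip (μ := (volume : Measure E))
      (ν := (volume : Measure E)) (L := innerₗ E) (f := W)
      (g := (oneSubLaplacian^[N] f : E → ℂ)) Real.continuous_fourierChar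
      (by exact continuous_inner) hW (oneSubLaplacian^[N] f).integrable
    rw [flip_innerₗ] at h3
    rw [h1]
    simp_rw [h2]
    exact h3.symm

end SchwartzMap

lemma SchwartzMap.exists_bump {E : Type*} [NormedAddCommGroup E] [InnerProductSpace ℝ E]
    [FiniteDimensional ℝ E] (a : E) : ∃ χ : 𝓢(E, ℂ), HasCompactSupport χ ∧ ∀ᶠ b in nhds a, χ b = 1 := by
  let f : ContDiffBump a := default
  have hc : HasCompactSupport fun x => (f x : ℂ) :=
    f.hasCompactSupport.comp_left (g := fun t : ℝ => (t : ℂ)) Complex.ofReal_zero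
  refine ⟨hc.toSchwartzMap (Complex.ofRealCLM.contDiff.comp f.contDiff), hc, ?_⟩
  filter_upwards [f.eventuallyEq_one] with b hb
  have hb' : f b = 1 := hb
  change (f b : ℂ) = 1
  rw [hb', Complex.ofReal_one]

/-! ### Twisted right translations and their derivatives. -/

namespace IsTwistedGroup

open scoped ContDiff

section Normed

variable {E : Type*} [NormedAddCommGroup E] [NormedSpace ℝ E] [MeasurableSpace E]
  {M : E → E → E} {A : E → E → ℝ} {μ : Measure E}

lemma growth_mul_left (h : IsTwistedGroup M A μ) (a : E) :
    (fun x => M x a).HasTemperateGrowth :=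
  h.growth_mul.comp (Function.HasTemperateGrowth.prodMk_const a)

lemma growth_cocycle_left (h : IsTwistedGroup M A μ) (a : E) :
    (fun x => Complex.exp (Complex.I * ((-A x a : ℝ) : ℂ))).HasTemperateGrowth :=
  Function.HasTemperateGrowth.cexp_I_mul.comp
    (h.growth_cocycle.comp (Function.HasTemperateGrowth.prodMk_const a)).neg

/-- The twisted right translation `x ↦ e^{-i A(x, a)} φ(x · a)` of Schwartz functions. -/
noncomputable def rtrans (h : IsTwistedGroup M A μ) (a : E) : 𝓢(E, ℂ) →L[ℂ] 𝓢(E, ℂ) :=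
  smulLeftCLM ℂ (fun x => Complex.exp (Complex.I * ((-A x a : ℝ) : ℂ))) ∘L
    compCLM ℂ (h.growth_mul_left a) (by
      -- The inverse map, translation by `-a`, also grows polynomially, so `x · a` cannot stay small
      -- while `x` grows.
      obtain ⟨k, C, hk⟩ := (h.growth_mul_left (-a)).exists_norm_le
      exact ⟨k, C, fun x => by simpa only [h.mul_mul_neg] using hk (M x a)⟩)

lemma rtrans_apply (h : IsTwistedGroup M A μ) (a : E) (φ : 𝓢(E, ℂ)) (x : E) :
    h.rtrans a φ x = Complex.exp (Complex.I * ((-A x a : ℝ) : ℂ)) * φ (M x a) := by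
  simp only [rtrans, ContinuousLinearMap.comp_apply]
  rw [smulLeftCLM_apply_apply (h.growth_cocycle_left a)]
  rfl

lemma rtrans_zero (h : IsTwistedGroup M A μ) (φ : 𝓢(E, ℂ)) : h.rtrans 0 φ = φ := by
  ext x
  simp [rtrans_apply, h.mul_zero, h.cocycle_zero_right]

/-- The cocycle identity: the translations form a projective representation. -/
lemma rtrans_mul (h : IsTwistedGroup M A μ) (a b : E) (φ : 𝓢(E, ℂ)) :
    h.rtrans (M a b) φ = Complex.exp (Complex.I * A a b) • h.rtrans a (h.rtrans b φ) := by
  ext x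
  have := h.cocycle x a b
  simp only [rtrans_apply, smul_apply, smul_eq_mul, h.assoc]
  rw [← mul_assoc, ← mul_assoc, ← Complex.exp_add, ← Complex.exp_add]
  congr 2
  have e : ((A (M x a) b : ℝ) : ℂ) = (A x (M a b) : ℝ) + (A a b : ℝ) - (A x a : ℝ) := by
    rw [← Complex.ofReal_add, ← Complex.ofReal_sub, ← this]
    simp
  push_cast
  rw [e]
  ring

/-- On compactly supported parameters the twisted right translates of a Schwartz function are the
slices of one Schwartz function of two variables. -/
lemma exists_slice_eq_rtrans (h : IsTwistedGroup M A μ) (φ χ : 𝓢(E, ℂ)) :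
    ∃ Ψ : 𝓢(E × E, ℂ), ∀ a, slice Ψ a = χ a • h.rtrans a φ := by
  have hgm : (fun z : E × E => (M z.1 z.2, z.2)).HasTemperateGrowth :=
    h.growth_mul.prodMk (ContinuousLinearMap.snd ℝ E E).hasTemperateGrowth
  have hinv : (fun z : E × E => (M z.1 (-z.2), z.2)).HasTemperateGrowth :=
    (h.growth_mul.comp ((ContinuousLinearMap.fst ℝ E E).prod
      (-ContinuousLinearMap.snd ℝ E E)).hasTemperateGrowth).prodMk
      (ContinuousLinearMap.snd ℝ E E).hasTemperateGrowth
  have hexp : (fun z : E × E => Complex.exp (Complex.I * ((-A z.1 z.2 : ℝ) : ℂ))).HasTemperateGrowth :=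
    Function.HasTemperateGrowth.cexp_I_mul.comp h.growth_cocycle.neg
  refine ⟨smulLeftCLM ℂ (fun z : E × E => Complex.exp (Complex.I * ((-A z.1 z.2 : ℝ) : ℂ)))
    (compCLM ℂ hgm ?_ (tensor φ χ)), fun a => ?_⟩
  · obtain ⟨k, C, hk⟩ := hinv.exists_norm_le
    exact ⟨k, C, fun z => by simpa only [h.mul_mul_neg] using hk (M z.1 z.2, z.2)⟩
  · ext x
    rw [slice_apply, smulLeftCLM_apply_apply hexp]
    simp only [compCLM_apply, Function.comp_apply, tensor_apply, smul_apply, rtrans_apply,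
      smul_eq_mul]
    ring

/-- For every Schwartz function, a joint smooth function of the point and the parameter. -/
lemma contDiff_rtrans (h : IsTwistedGroup M A μ) (φ : 𝓢(E, ℂ)) :
    ContDiff ℝ ∞ fun z : E × E => h.rtrans z.2 φ z.1 := by
  simp only [rtrans_apply]
  exact (Function.HasTemperateGrowth.cexp_I_mul.comp h.growth_cocycle.neg).1.mul
    ((φ.smooth ⊤).comp h.growth_mul.1)

/-! ### Invariant differential operators -/

/-- The partial derivative of the multiplication in its second variable at the origin. -/
noncomputable def dmul (M : E → E → E) (v x : E) : E := fderiv ℝ (fun z : E × E => M z.1 z.2) (x, 0) (0, v)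

/-- The partial derivative of the cocycle in its second variable at the origin. -/
noncomputable def dcocycle (A : E → E → ℝ) (v x : E) : ℝ :=
  fderiv ℝ (fun z : E × E => A z.1 z.2) (x, 0) (0, v)

lemma growth_dmul (h : IsTwistedGroup M A μ) (v : E) : (dmul M v).HasTemperateGrowth :=
  ((ContinuousLinearMap.apply ℝ E ((0, v) : E × E)).hasTemperateGrowth.comp h.growth_mul.fderiv).comp
    (Function.HasTemperateGrowth.prodMk_const 0)

lemma growth_dcocycle (h : IsTwistedGroup M A μ) (v : E) : (dcocycle A v).HasTemperateGrowth :=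
  ((ContinuousLinearMap.apply ℝ ℝ ((0, v) : E × E)).hasTemperateGrowth.comp
    h.growth_cocycle.fderiv).comp (Function.HasTemperateGrowth.prodMk_const 0)

/-- The velocity of the curve `y · (-(y + s v))` at `s = 0`. -/
noncomputable def dinv (M : E → E → E) (v y : E) : E :=
  fderiv ℝ (fun z : E × E => M z.1 z.2) (y, -y) (0, -v)

attribute [irreducible] rtrans

end Normed

variable {E : Type*} [NormedAddCommGroup E] [InnerProductSpace ℝ E] [FiniteDimensional ℝ E]
  [MeasurableSpace E] {M : E → E → E} {A : E → E → ℝ} {μ : Measure E}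

/-- Near `a` a cutoff equals `1`, so the translates there are slices of a single Schwartz function.
-/
theorem continuous_rtrans (h : IsTwistedGroup M A μ) (φ : 𝓢(E, ℂ)) :
    Continuous fun a => h.rtrans a φ := by
  rw [continuous_iff_continuousAt]
  intro a
  obtain ⟨χ, -, hχ⟩ := exists_bump a
  obtain ⟨Ψ, hΨ⟩ := h.exists_slice_eq_rtrans φ χ
  refine (continuous_slice Ψ).continuousAt.congr ?_
  filter_upwards [hχ] with b hb
  rw [hΨ, hb, one_smul]

open LineDeriv

/-- The derivative of the twisted right translations in the direction `v`. -/
noncomputable def generator (_ : IsTwistedGroup M A μ) (v : E) : 𝓢(E, ℂ) →L[ℂ] 𝓢(E, ℂ) :=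
  ∑ k, smulLeftCLM ℂ (fun x => ((inner ℝ (stdOrthonormalBasis ℝ E k) (dmul M v x) : ℝ) : ℂ)) ∘L
      lineDerivOpCLM ℂ 𝓢(E, ℂ) (stdOrthonormalBasis ℝ E k) -
    smulLeftCLM ℂ (fun x => Complex.I * (dcocycle A v x : ℂ))

lemma generator_apply (h : IsTwistedGroup M A μ) (v : E) (φ : 𝓢(E, ℂ)) (x : E) :
    h.generator v φ x =
      fderiv ℝ φ x (dmul M v x) - Complex.I * (dcocycle A v x : ℂ) * φ x := by
  have h1 : ∀ k, (fun x => ((inner ℝ (stdOrthonormalBasis ℝ E k) (dmul M v x) : ℝ) : ℂ)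
      ).HasTemperateGrowth := fun k => Complex.ofRealCLM.hasTemperateGrowth.comp
    ((innerSL ℝ (stdOrthonormalBasis ℝ E k)).hasTemperateGrowth.comp (h.growth_dmul v))
  have h2 : (fun x => Complex.I * (dcocycle A v x : ℂ)).HasTemperateGrowth :=
    (Function.HasTemperateGrowth.const _).mul
      (Complex.ofRealCLM.hasTemperateGrowth.comp (h.growth_dcocycle v))
  simp only [generator, sub_apply, _root_.sum_apply, ContinuousLinearMap.comp_apply]
  rw [smulLeftCLM_apply_apply h2]
  simp_rw [fun k => smulLeftCLM_apply_apply (F := ℂ) (h1 k)]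
  simp only [lineDerivOpCLM_apply, lineDerivOp_apply_eq_fderiv, smul_eq_mul]
  congr 1
  conv_rhs => rw [← (stdOrthonormalBasis ℝ E).sum_repr' (dmul M v x), map_sum]
  simp only [map_smul, Complex.real_smul]

/-- A general curve `w` through `0` is allowed because `y · (-(y + s v))`, to which this is applied,
need not be a straight line. -/
lemma hasDerivAt_rtrans (h : IsTwistedGroup M A μ) (φ : 𝓢(E, ℂ)) (x : E) {w : ℝ → E} {v : E}
    (hw0 : w 0 = 0) (hw : HasDerivAt w v 0) :
    HasDerivAt (fun s => h.rtrans (w s) φ x) (h.generator v φ x) 0 := by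
  have hpair : HasDerivAt (fun s => (x, w s)) ((0 : E), v) 0 := (hasDerivAt_const _ _).prodMk hw
  have hM : HasDerivAt (fun s => M x (w s)) (dmul M v x) 0 := by
    have h0 : HasFDerivAt (fun z : E × E => M z.1 z.2) _ (x, w 0) :=
      (h.growth_mul.1.differentiable (by simp) (x, w 0)).hasFDerivAt
    have := h0.comp_hasDerivAt 0 hpair
    rwa [hw0] at this
  have hA : HasDerivAt (fun s => A x (w s)) (dcocycle A v x) 0 := by
    have h0 : HasFDerivAt (fun z : E × E => A z.1 z.2) _ (x, w 0) :=
      (h.growth_cocycle.1.differentiable (by simp) (x, w 0)).hasFDerivAt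
    have := h0.comp_hasDerivAt 0 hpair
    rwa [hw0] at this
  have hφ : HasDerivAt (fun s => φ (M x (w s))) (fderiv ℝ φ x (dmul M v x)) 0 := by
    have h0 : HasFDerivAt φ (fderiv ℝ φ (M x (w 0))) (M x (w 0)) :=
      (φ.differentiable _).hasFDerivAt
    have := h0.comp_hasDerivAt 0 hM
    rwa [hw0, h.mul_zero] at this
  have he := ((hA.neg.ofReal_comp).const_mul Complex.I).cexp
  have := he.mul hφ
  simp only [rtrans_apply]
  refine this.congr_deriv ?_
  rw [generator_apply]
  simp only [Pi.neg_apply, hw0, h.cocycle_zero_right, h.mul_zero]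
  simp
  ring

/-- Linearity in `v` lets a direction depending on `y` be replaced by scalar coefficients in `y`
times finitely many fixed operators. -/
lemma generator_eq_sum (h : IsTwistedGroup M A μ) (v : E) (φ : 𝓢(E, ℂ)) :
    h.generator v φ = ∑ k, ((inner ℝ (stdOrthonormalBasis ℝ E k) v : ℝ) : ℂ) •
      h.generator (stdOrthonormalBasis ℝ E k) φ := by
  have hv : v = ∑ k, inner ℝ (stdOrthonormalBasis ℝ E k) v • stdOrthonormalBasis ℝ E k :=
    ((stdOrthonormalBasis ℝ E).sum_repr' v).symm
  have hpair : ((0 : E), v) = ∑ k, inner ℝ (stdOrthonormalBasis ℝ E k) v •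
      ((0 : E), stdOrthonormalBasis ℝ E k) := by
    conv_lhs => rw [hv]
    ext <;> simp [Prod.fst_sum, Prod.snd_sum]
  ext x
  simp only [_root_.sum_apply, smul_apply, generator_apply]
  have h1 : dmul M v x = ∑ k, inner ℝ (stdOrthonormalBasis ℝ E k) v •
      dmul M (stdOrthonormalBasis ℝ E k) x := by
    simp only [dmul]
    rw [hpair, map_sum]
    simp only [map_smul]
  have h2 : dcocycle A v x = ∑ k, inner ℝ (stdOrthonormalBasis ℝ E k) v *
      dcocycle A (stdOrthonormalBasis ℝ E k) x := by
    simp only [dcocycle]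
    rw [hpair, map_sum]
    simp only [map_smul, smul_eq_mul]
  rw [h1, h2, map_sum]
  simp only [map_smul, Complex.real_smul, smul_eq_mul, mul_sub, Finset.sum_sub_distrib]
  congr 1
  push_cast
  rw [Finset.mul_sum, Finset.sum_mul]
  exact Finset.sum_congr rfl fun k _ => by ring

/-- Writing `-(y + s v) = (-y) · w(s)` with `w(0) = 0`, `rtrans_mul` splits the translation into a
phase, `R_{-y}` and `R_{w(s)}`. Only the phase and the last factor vary with `s`. -/
lemma hasDerivAt_rtrans_neg (h : IsTwistedGroup M A μ) (φ : 𝓢(E, ℂ)) (x y v : E) :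
    HasDerivAt (fun s : ℝ => h.rtrans (-(y + s • v)) φ x)
      (Complex.I * (dcocycle A (dinv M v y) (-y) : ℂ) * h.rtrans (-y) φ x +
        h.rtrans (-y) (h.generator (dinv M v y) φ) x) 0 := by
  let w : ℝ → E := fun s => M y (-(y + s • v))
  have hw0 : w 0 = 0 := by simp [w, h.mul_neg]
  have hw : HasDerivAt w (dinv M v y) 0 := by
    have h1 : HasDerivAt (fun s : ℝ => (y, -(y + s • v))) ((0 : E), -v) 0 := by
      have := ((hasDerivAt_id (0 : ℝ)).smul_const v).const_add y
      simp only [id, one_smul] at this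
      exact (hasDerivAt_const _ _).prodMk this.neg
    have h0 : HasFDerivAt (fun z : E × E => M z.1 z.2) _ (y, -(y + (0 : ℝ) • v)) :=
      (h.growth_mul.1.differentiable (by simp) _).hasFDerivAt
    have := h0.comp_hasDerivAt 0 h1
    rw [zero_smul, add_zero] at this
    exact this
  have hA : HasDerivAt (fun s => A (-y) (w s)) (dcocycle A (dinv M v y) (-y)) 0 := by
    have hpair : HasDerivAt (fun s => (-y, w s)) ((0 : E), dinv M v y) 0 :=
      (hasDerivAt_const _ _).prodMk hw
    have h0 : HasFDerivAt (fun z : E × E => A z.1 z.2) _ (-y, w 0) :=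
      (h.growth_cocycle.1.differentiable (by simp) (-y, w 0)).hasFDerivAt
    have := h0.comp_hasDerivAt 0 hpair
    rwa [hw0] at this
  have he := ((hA.ofReal_comp).const_mul Complex.I).cexp
  have hr := (h.hasDerivAt_rtrans φ (M x (-y)) hw0 hw).const_mul
    (Complex.exp (Complex.I * ((-A x (-y) : ℝ) : ℂ)))
  have hall := he.mul hr
  have hfun : (fun s : ℝ => h.rtrans (-(y + s • v)) φ x) = fun s =>
      Complex.exp (Complex.I * (A (-y) (w s) : ℂ)) *
        (Complex.exp (Complex.I * ((-A x (-y) : ℝ) : ℂ)) * h.rtrans (w s) φ (M x (-y))) := by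
    funext s
    have hs : -(y + s • v) = M (-y) (w s) := (h.neg_mul_mul_self y _).symm
    rw [hs, rtrans_mul, smul_apply, smul_eq_mul, rtrans_apply h (-y)]
  rw [hfun]
  refine hall.congr_deriv ?_
  simp only [hw0, h.cocycle_zero_right, h.rtrans_zero]
  rw [rtrans_apply h (-y), rtrans_apply h (-y)]
  simp

end IsTwistedGroup

/-! ### Factorization of Schwartz functions through twisted convolutions. -/

namespace IsTwistedGroup

open scoped ContDiff
open LineDeriv Laplacian

section

variable {E : Type*} [NormedAddCommGroup E] [NormedSpace ℝ E] [MeasurableSpace E]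
  {M : E → E → E} {A : E → E → ℝ} {μ : Measure E}

/-- The family of operators `φ ↦ b(y) R_{-y} D φ`, where `R` is the twisted right translation. -/
noncomputable def family (h : IsTwistedGroup M A μ) (b : E → ℂ) (D : 𝓢(E, ℂ) →L[ℂ] 𝓢(E, ℂ)) :
    𝓢(E, ℂ) → E → E → ℂ := fun φ x y => b y * h.rtrans (-y) (D φ) x

/-- The span of the families with smooth compactly supported coefficients. -/
noncomputable def families (h : IsTwistedGroup M A μ) : Submodule ℂ (𝓢(E, ℂ) → E → E → ℂ) :=
  Submodule.span ℂ {T | ∃ b D, ContDiff ℝ ∞ b ∧ HasCompactSupport b ∧ T = h.family b D}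

lemma family_mem_families (h : IsTwistedGroup M A μ) {b : E → ℂ} (hb : ContDiff ℝ ∞ b)
    (hb' : HasCompactSupport b) (D : 𝓢(E, ℂ) →L[ℂ] 𝓢(E, ℂ)) : h.family b D ∈ h.families :=
  Submodule.subset_span ⟨b, D, hb, hb', rfl⟩

lemma contDiff_rtrans_neg_apply (h : IsTwistedGroup M A μ) (φ : 𝓢(E, ℂ)) (x : E) :
    ContDiff ℝ ∞ fun y => h.rtrans (-y) φ x := by
  have hp : ContDiff ℝ ∞ fun y : E => (x, -y) := contDiff_const.prodMk contDiff_neg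
  exact ContDiff.comp (g := fun z : E × E => h.rtrans z.2 φ z.1) (h.contDiff_rtrans φ) hp

lemma contDiff_of_mem_families (h : IsTwistedGroup M A μ) {T : 𝓢(E, ℂ) → E → E → ℂ}
    (hT : T ∈ h.families) (φ : 𝓢(E, ℂ)) (x : E) :
    ContDiff ℝ ∞ (T φ x) ∧ HasCompactSupport (T φ x) := by
  refine Submodule.span_induction
    (p := fun T _ => ContDiff ℝ ∞ (T φ x) ∧ HasCompactSupport (T φ x)) ?_ ?_ ?_ ?_ hT
  · rintro _ ⟨b, D, hb, hb', rfl⟩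
    have hs := h.contDiff_rtrans_neg_apply (D φ) x
    exact ⟨ContDiff.mul (f := b) (g := fun y => h.rtrans (-y) (D φ) x) hb hs,
      HasCompactSupport.mul_right (f := b) (f' := fun y => h.rtrans (-y) (D φ) x) hb'⟩
  · exact ⟨contDiff_const, HasCompactSupport.zero⟩
  · exact fun T T' _ _ h h' => ⟨h.1.add h'.1, h.2.add h'.2⟩
  · exact fun r T _ h => ⟨h.1.const_smul r, HasCompactSupport.smul_left (f := fun _ : E => r) (f' := T φ x) h.2⟩

lemma contDiff_dinv (h : IsTwistedGroup M A μ) (v : E) : ContDiff ℝ ∞ (dinv M v) :=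
  ((h.growth_mul.1.fderiv_right (by simp)).comp (contDiff_id.prodMk contDiff_neg)).clm_apply
    contDiff_const

lemma contDiff_dcocycle_dinv (h : IsTwistedGroup M A μ) (v : E) :
    ContDiff ℝ ∞ fun y => dcocycle A (dinv M v y) (-y) :=
  ((h.growth_cocycle.1.fderiv_right (by simp)).comp (contDiff_neg.prodMk contDiff_const)).clm_apply
    (contDiff_const.prodMk (h.contDiff_dinv v))

end

variable {E : Type*} [NormedAddCommGroup E] [InnerProductSpace ℝ E] [FiniteDimensional ℝ E]
  [MeasurableSpace E] {M : E → E → E} {A : E → E → ℝ} {μ : Measure E}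

/-- Differentiation in `y` hits the coefficient `b`, the phase or the translation. Each time the new
coefficient is a smooth compactly supported function of `y` alone and the new operator is fixed, so
the form persists. -/
lemma exists_deriv_mem_families (h : IsTwistedGroup M A μ) {T : 𝓢(E, ℂ) → E → E → ℂ}
    (hT : T ∈ h.families) (v : E) : ∃ T' ∈ h.families, ∀ φ x y,
      HasDerivAt (fun s : ℝ => T φ x (y + s • v)) (T' φ x y) 0 := by
  refine Submodule.span_induction (p := fun T _ => ∃ T' ∈ h.families, ∀ φ x y,
      HasDerivAt (fun s : ℝ => T φ x (y + s • v)) (T' φ x y) 0) ?_ ?_ ?_ ?_ hT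
  · rintro _ ⟨b, D, hb, hb', rfl⟩
    refine ⟨h.family (fun y => fderiv ℝ b y v) D +
      (h.family (fun y => b y * (Complex.I * (dcocycle A (dinv M v y) (-y) : ℂ))) D +
      ∑ k, h.family (fun y => b y *
          ((inner ℝ (stdOrthonormalBasis ℝ E k) (dinv M v y) : ℝ) : ℂ))
        (h.generator (stdOrthonormalBasis ℝ E k) ∘L D)), ?_, fun φ x y => ?_⟩
    · have s₁ : ContDiff ℝ ∞ fun y => fderiv ℝ b y v :=
        (hb.fderiv_right (by simp)).clm_apply contDiff_const
      have s₂ : ContDiff ℝ ∞ fun y => (dcocycle A (dinv M v y) (-y) : ℂ) :=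
        Complex.ofRealCLM.contDiff.comp (h.contDiff_dcocycle_dinv v)
      have s₃ : ∀ k, ContDiff ℝ ∞ fun y =>
          ((inner ℝ (stdOrthonormalBasis ℝ E k) (dinv M v y) : ℝ) : ℂ) := fun k =>
        Complex.ofRealCLM.contDiff.comp (contDiff_const.inner ℝ (h.contDiff_dinv v))
      refine add_mem ?_ (add_mem ?_ (Submodule.sum_mem _ fun k _ => ?_))
      · exact h.family_mem_families s₁ (hb'.fderiv_apply ℝ v) D
      · exact h.family_mem_families (hb.mul (contDiff_const.mul s₂)) hb'.mul_right D
      · exact h.family_mem_families (hb.mul (s₃ k)) hb'.mul_right _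
    · have hbd : HasDerivAt (fun s : ℝ => b (y + s • v)) (fderiv ℝ b y v) 0 := by
        have h1 : HasDerivAt (fun s : ℝ => y + s • v) v 0 := by
          have := ((hasDerivAt_id (0 : ℝ)).smul_const v).const_add y
          simpa using! this
        have h0 : HasFDerivAt b _ (y + (0 : ℝ) • v) := (hb.differentiable (by simp) _).hasFDerivAt
        have := h0.comp_hasDerivAt 0 h1
        rwa [zero_smul, add_zero] at this
      refine (hbd.mul (h.hasDerivAt_rtrans_neg (D φ) x y v)).congr_deriv ?_
      rw [generator_eq_sum]
      simp only [family, Pi.add_apply, Finset.sum_apply, map_sum, map_smul, _root_.sum_apply,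
        smul_apply, smul_eq_mul, ContinuousLinearMap.comp_apply, zero_smul, add_zero, mul_add,
        Finset.mul_sum, mul_assoc]
  · exact ⟨0, zero_mem _, fun φ x y => hasDerivAt_const _ _⟩
  · rintro T₁ T₂ _ _ ⟨T₁', h₁, h₁'⟩ ⟨T₂', h₂, h₂'⟩
    exact ⟨T₁' + T₂', add_mem h₁ h₂, fun φ x y => (h₁' φ x y).add (h₂' φ x y)⟩
  · rintro r T _ ⟨T', h₁, h₁'⟩
    exact ⟨r • T', Submodule.smul_mem _ _ h₁, fun φ x y => (h₁' φ x y).const_smul r⟩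

lemma exists_oneSubLaplacian_mem_families (h : IsTwistedGroup M A μ)
    {T : 𝓢(E, ℂ) → E → E → ℂ} (hT : T ∈ h.families) : ∃ T' ∈ h.families, ∀ φ x (F : 𝓢(E, ℂ)),
      ⇑F = T φ x → ⇑(oneSubLaplacian F) = T' φ x := by
  choose T₁ hT₁ hd₁ using fun k => h.exists_deriv_mem_families hT (stdOrthonormalBasis ℝ E k)
  choose T₂ hT₂ hd₂ using fun k => h.exists_deriv_mem_families (hT₁ k) (stdOrthonormalBasis ℝ E k)
  refine ⟨T - (((2 * Real.pi) ^ 2)⁻¹ : ℂ) • ∑ k, T₂ k, sub_mem hT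
    (Submodule.smul_mem _ _ (Submodule.sum_mem _ fun k _ => hT₂ k)), fun φ x F hF => ?_⟩
  have h₁ : ∀ k, ⇑(∂_{stdOrthonormalBasis ℝ E k} F : 𝓢(E, ℂ)) = T₁ k φ x := fun k => by
    funext y
    rw [lineDerivOp_apply, hF]
    exact (hd₁ k φ x y).deriv
  have h₂ : ∀ k y, (∂_{stdOrthonormalBasis ℝ E k} (∂_{stdOrthonormalBasis ℝ E k} F) : 𝓢(E, ℂ)) y =
      T₂ k φ x y := fun k y => by
    rw [lineDerivOp_apply, h₁]
    exact (hd₂ k φ x y).deriv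
  funext y
  rw [oneSubLaplacian, laplacian_eq_sum (stdOrthonormalBasis ℝ E)]
  simp only [sub_apply, smul_apply, _root_.sum_apply, h₂, hF, Pi.sub_apply, Pi.smul_apply,
    Finset.sum_apply, Complex.real_smul, smul_eq_mul]
  push_cast
  rfl

lemma exists_oneSubLaplacian_iterate_mem_families (h : IsTwistedGroup M A μ)
    {T : 𝓢(E, ℂ) → E → E → ℂ} (hT : T ∈ h.families) (N : ℕ) :
    ∃ T' ∈ h.families, ∀ φ x (F : 𝓢(E, ℂ)),
      ⇑F = T φ x → ⇑(oneSubLaplacian^[N] F) = T' φ x := by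
  induction N with
  | zero => exact ⟨T, hT, fun φ x F hF => hF⟩
  | succ N ih =>
    obtain ⟨T₁, hT₁, h₁⟩ := ih
    obtain ⟨T₂, hT₂, h₂⟩ := h.exists_oneSubLaplacian_mem_families hT₁
    refine ⟨T₂, hT₂, fun φ x F hF => ?_⟩
    rw [Function.iterate_succ_apply']
    exact h₂ φ x _ (h₁ φ x F hF)

variable [BorelSpace E]

/-- Schwartz functions factor through finitely many twisted convolutions with continuous
compactly supported functions. -/
theorem exists_factorization (h : IsTwistedGroup M A μ) [μ.IsAddHaarMeasure] :
    ∃ (n : ℕ) (ψ : Fin n → E → ℂ) (D : Fin n → 𝓢(E, ℂ) →L[ℂ] 𝓢(E, ℂ)),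
      (∀ i, Continuous (ψ i)) ∧ (∀ i, HasCompactSupport (ψ i)) ∧
      ∀ φ x, φ x = ∑ i, ∫ y, h.rtrans (-y) (D i φ) x * ψ i y ∂μ := by
  obtain ⟨N, w, hw, hrep⟩ := exists_apply_zero_eq_integral (E := E)
  obtain ⟨χ, hχ, hχ1⟩ := exists_bump (0 : E)
  -- The initial family `χ(y) (R_{-y} φ)(x)` has the value `φ(x)` at `y = 0`.
  have hT₀ := h.family_mem_families (χ.smooth ⊤) hχ (ContinuousLinearMap.id ℂ _)
  obtain ⟨T, hT, hTF⟩ := h.exists_oneSubLaplacian_iterate_mem_families hT₀ N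
  obtain ⟨n, r, f, hf⟩ := Submodule.mem_span_set'.1 hT
  choose b D hb hb' hbD using fun i => (f i).2
  set c : ℝ := (Measure.addHaarScalarFactor (volume : Measure E) μ : ℝ)
  -- The constant `c` compares `volume` with `μ`; the rest of `ψ i` is `w` times the scalar and
  -- coefficient of the `i`-th family.
  refine ⟨n, fun i y => (c : ℂ) * (w y * (r i * b i y)), D, fun i => ?_, fun i => ?_,
    fun φ x => ?_⟩
  · exact continuous_const.mul (hw.mul (continuous_const.mul (hb i).continuous))
  · exact ((hb' i).mul_left.mul_left).mul_left
  · have hF := h.contDiff_of_mem_families hT₀ φ x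
    have h1 := hrep (hF.2.toSchwartzMap hF.1)
    have h0 : hF.2.toSchwartzMap hF.1 0 = φ x := by
      change χ 0 * h.rtrans (-0) φ x = φ x
      rw [neg_zero, h.rtrans_zero, hχ1.self_of_nhds, one_mul]
    rw [h0, hTF φ x _ rfl, ← hf, Measure.isAddLeftInvariant_eq_smul (volume : Measure E) μ,
      integral_smul_nnreal_measure] at h1
    rw [h1]
    have hint : ∀ i, Integrable (fun y => w y * (r i * (b i y * h.rtrans (-y) (D i φ) x))) μ :=
      fun i => Continuous.integrable_of_hasCompactSupport
        (hw.mul (continuous_const.mul ((hb i).continuous.mul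
          ((h.contDiff_rtrans_neg_apply (D i φ) x).continuous)))) ((hb' i).mul_right.mul_left.mul_left)
    have hsum : ∀ y, w y * (∑ i, r i • (f i : 𝓢(E, ℂ) → E → E → ℂ)) φ x y =
        ∑ i, w y * (r i * (b i y * h.rtrans (-y) (D i φ) x)) := fun y => by
      simp only [Finset.sum_apply, Pi.smul_apply, smul_eq_mul, hbD, family, Finset.mul_sum]
    simp_rw [hsum]
    rw [integral_finsetSum _ fun i _ => hint i, NNReal.smul_def, Complex.real_smul,
      Finset.mul_sum]
    refine Finset.sum_congr rfl fun i _ => ?_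
    rw [← integral_const_mul]
    exact integral_congr_ae (Filter.Eventually.of_forall fun y => by simp only [c]; ring)

end IsTwistedGroup

/-! ### Continuity, integrability and approximation for twisted convolutions. -/

open Filter Topology

/-- Schwartz functions are dominated by a fixed `L^p` function times a continuous seminorm. -/
lemma SchwartzMap.exists_norm_le_mul {E : Type*} [NormedAddCommGroup E] [NormedSpace ℝ E]
    [MeasurableSpace E] (p : ℝ≥0∞) (μ : Measure E) [hμ : μ.HasTemperateGrowth] :
    ∃ (S : 𝓢(E, ℂ) → ℝ) (W : E → ℝ), Continuous S ∧ S 0 = 0 ∧ eLpNorm W p μ < ⊤ ∧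
      (∀ x, 0 ≤ W x) ∧ ∀ f x, ‖f x‖ ≤ S f * W x := by
  obtain ⟨k, hk⟩ := hμ.exists_eLpNorm_lt_top p
  refine ⟨fun f => 2 ^ (k - 1) * (SchwartzMap.seminorm ℂ 0 0 f + SchwartzMap.seminorm ℂ k 0 f), _,
    ?_, by simp, hk, fun x => Real.rpow_nonneg (by positivity) _, fun f x => ?_⟩
  · exact continuous_const.mul
      (((schwartz_withSeminorms ℂ E ℂ).continuous_seminorm (0, 0)).add
        ((schwartz_withSeminorms ℂ E ℂ).continuous_seminorm (k, 0)))
  · have hpos : 0 < 1 + ‖x‖ := by positivity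
    rw [Real.rpow_neg hpos.le, Real.rpow_natCast, ← div_eq_mul_inv, le_div_iff₀ (by positivity)]
    have h1 := f.norm_le_seminorm ℂ x
    have h2 := f.norm_pow_mul_le_seminorm ℂ k x
    calc ‖f x‖ * (1 + ‖x‖) ^ k
        ≤ ‖f x‖ * (2 ^ (k - 1) * (1 ^ k + ‖x‖ ^ k)) := by
          gcongr
          exact add_pow_le zero_le_one (norm_nonneg x) k
      _ = 2 ^ (k - 1) * (‖f x‖ + ‖x‖ ^ k * ‖f x‖) := by ring
      _ ≤ 2 ^ (k - 1) * (SchwartzMap.seminorm ℂ 0 0 f + SchwartzMap.seminorm ℂ k 0 f) :=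
          mul_le_mul_of_nonneg_left (add_le_add h1 h2) (by positivity)

/-- Averages against a normalized bump function are close to the value at its center. -/
lemma ContDiffBump.norm_integral_mul_normed_sub_le {E : Type*} [NormedAddCommGroup E]
    [InnerProductSpace ℝ E] [FiniteDimensional ℝ E] [MeasurableSpace E] [BorelSpace E]
    {μ : Measure E} [μ.IsAddHaarMeasure] {c : E} (f : ContDiffBump c) {G : E → ℂ}
    (hG : Continuous G) {v : ℂ} {ε : ℝ} (h : ∀ y ∈ Metric.ball c f.rOut, ‖G y - v‖ ≤ ε) :
    ‖(∫ y, G y * (f.normed μ y : ℂ) ∂μ) - v‖ ≤ ε := by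
  have hc : Continuous fun y => (f.normed μ y : ℂ) := Complex.continuous_ofReal.comp f.continuous_normed
  have hs : HasCompactSupport fun y => (f.normed μ y : ℂ) :=
    f.hasCompactSupport_normed.comp_left (g := fun t : ℝ => (t : ℂ)) Complex.ofReal_zero
  have h1 : ∫ y, (f.normed μ y : ℂ) ∂μ = 1 := by
    rw [integral_complex_ofReal, f.integral_normed, Complex.ofReal_one]
  have h2 : (∫ y, G y * (f.normed μ y : ℂ) ∂μ) - v = ∫ y, (G y - v) * (f.normed μ y : ℂ) ∂μ := by
    have hi1 : Integrable (fun y => G y * (f.normed μ y : ℂ)) μ :=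
      (hG.mul hc).integrable_of_hasCompactSupport hs.mul_left
    have hi2 : Integrable (fun y => v * (f.normed μ y : ℂ)) μ :=
      (continuous_const.mul hc).integrable_of_hasCompactSupport hs.mul_left
    simp_rw [sub_mul]
    rw [integral_sub hi1 hi2, integral_const_mul, h1, mul_one]
  have h3 : ∫ y, ε * f.normed μ y ∂μ = ε := by
    rw [integral_const_mul, f.integral_normed, mul_one]
  rw [h2, ← h3]
  refine norm_integral_le_of_norm_le (f.integrable_normed.const_mul ε)
    (Eventually.of_forall fun y => ?_)
  rw [norm_mul, Complex.norm_real, Real.norm_of_nonneg (f.nonneg_normed y)]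
  by_cases hy : y ∈ Metric.ball c f.rOut
  · exact mul_le_mul_of_nonneg_right (h y hy) (f.nonneg_normed y)
  · rw [← f.support_normed_eq (μ := μ), Function.mem_support, not_not] at hy
    simp [hy]

/-- A sequence of bump functions at `c` whose supports shrink to `c`. -/
noncomputable def shrinkingBump {E : Type*} [NormedAddCommGroup E] [InnerProductSpace ℝ E]
    [FiniteDimensional ℝ E] (c : E) (n : ℕ) : ContDiffBump c where
  rIn := 1 / ((n : ℝ) + 1) / 2
  rOut := 1 / ((n : ℝ) + 1)
  rIn_pos := by positivity
  rIn_lt_rOut := half_lt_self (by positivity)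

lemma eventually_ball_shrinkingBump {E : Type*} [NormedAddCommGroup E] [InnerProductSpace ℝ E]
    [FiniteDimensional ℝ E] {c : E} {P : E → Prop} (hP : ∀ᶠ y in 𝓝 c, P y) :
    ∀ᶠ n in atTop, ∀ y ∈ Metric.ball c (shrinkingBump c n).rOut, P y := by
  obtain ⟨δ, hδ, hb⟩ := Metric.eventually_nhds_iff_ball.1 hP
  filter_upwards [(tendsto_one_div_add_atTop_nhds_zero_nat (𝕜 := ℝ)).eventually_lt_const hδ]
    with n hn y hy
  exact hb y (Metric.ball_subset_ball hn.le hy)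

namespace IsTwistedGroup

variable {E : Type*} [NormedAddCommGroup E] [MeasurableSpace E] {M : E → E → E} {A : E → E → ℝ}
  {μ : Measure E}

/-- The twisted convolution. -/
noncomputable def tconv (M : E → E → E) (A : E → E → ℝ) (μ : Measure E) (φ ψ : E → ℂ) (x : E) : ℂ :=
  ∫ y, φ (M x (-y)) * Complex.exp (Complex.I * A (M x (-y)) y) * ψ y ∂μ

lemma tconv_congr_right {ψ ψ' : E → ℂ} (φ : E → ℂ) (hψ : ψ =ᵐ[μ] ψ') :
    tconv M A μ φ ψ = tconv M A μ φ ψ' := by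
  funext x
  refine integral_congr_ae ?_
  filter_upwards [hψ] with z hz
  rw [hz]

variable [InnerProductSpace ℝ E]

lemma tconv_eq_integral_rtrans (h : IsTwistedGroup M A μ) (φ : 𝓢(E, ℂ)) (ψ : E → ℂ) (x : E) :
    tconv M A μ φ ψ x = ∫ y, h.rtrans (-y) φ x * ψ y ∂μ := by
  refine integral_congr_ae (Eventually.of_forall fun y => ?_)
  simp only [rtrans_apply, h.cocycle_mul_neg]
  ring

lemma continuous_mul (h : IsTwistedGroup M A μ) {X : Type*} [TopologicalSpace X] {f g : X → E}
    (hf : Continuous f) (hg : Continuous g) : Continuous fun x => M (f x) (g x) :=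
  h.growth_mul.1.continuous.comp (hf.prodMk hg)

lemma continuous_cocycle (h : IsTwistedGroup M A μ) {X : Type*} [TopologicalSpace X] {f g : X → E}
    (hf : Continuous f) (hg : Continuous g) : Continuous fun x => A (f x) (g x) :=
  h.growth_cocycle.1.continuous.comp (hf.prodMk hg)

lemma mul_neg_mul_neg (h : IsTwistedGroup M A μ) (x y : E) : M (-(M x (-y))) x = y := by
  rw [← h.mul_neg_neg, neg_neg, h.mul_neg_mul]

lemma mul_neg_neg_mul (h : IsTwistedGroup M A μ) (x z : E) : M x (-(M (-z) x)) = z := by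
  rw [← h.mul_neg_neg, neg_neg, h.mul_neg_mul_self]

variable [FiniteDimensional ℝ E] [BorelSpace E]

/-- The measurable equivalence `y ↦ x · (-y)`, with inverse `z ↦ (-z) · x`. -/
noncomputable def mulNegEquiv (h : IsTwistedGroup M A μ) (x : E) : E ≃ᵐ E where
  toFun y := M x (-y)
  invFun z := M (-z) x
  left_inv y := h.mul_neg_mul_neg x y
  right_inv z := h.mul_neg_neg_mul x z
  measurable_toFun := (h.continuous_mul continuous_const continuous_neg).measurable
  measurable_invFun := (h.continuous_mul continuous_neg continuous_const).measurable

lemma measurePreserving_mulNegEquiv (h : IsTwistedGroup M A μ) [μ.IsAddHaarMeasure] (x : E) :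
    MeasurePreserving (h.mulNegEquiv x) μ μ := by
  have : MeasurePreserving (h.mulNegEquiv x).symm μ μ :=
    (h.measurePreserving x).comp (Measure.measurePreserving_neg μ)
  exact this.symm

/-- The measure-preserving substitution `z = x · (-y)` moves the dependence on `x` away from `φ`,
which may then be a mere class of functions. -/
lemma tconv_eq_integral (h : IsTwistedGroup M A μ) [μ.IsAddHaarMeasure] (φ ψ : E → ℂ) (x : E) :
    tconv M A μ φ ψ x =
      ∫ z, φ z * (Complex.exp (Complex.I * A z (M (-z) x)) * ψ (M (-z) x)) ∂μ := by
  rw [← (h.measurePreserving_mulNegEquiv x).integral_comp']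
  refine integral_congr_ae (Eventually.of_forall fun y => ?_)
  simp only [mulNegEquiv, MeasurableEquiv.coe_mk, Equiv.coe_fn_mk, h.mul_neg_mul_neg]
  ring

lemma tconv_congr_left (h : IsTwistedGroup M A μ) [μ.IsAddHaarMeasure] {φ φ' : E → ℂ}
    (hφ : φ =ᵐ[μ] φ') (ψ : E → ℂ) : tconv M A μ φ ψ = tconv M A μ φ' ψ := by
  funext x
  rw [h.tconv_eq_integral, h.tconv_eq_integral]
  refine integral_congr_ae ?_
  filter_upwards [hφ] with z hz
  rw [hz]

lemma tconv_apply_zero (h : IsTwistedGroup M A μ) [μ.IsAddHaarMeasure] (φ ψ : E → ℂ) :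
    tconv M A μ φ ψ 0 = ∫ z, φ z * ψ (-z) ∂μ := by
  rw [h.tconv_eq_integral]
  refine integral_congr_ae (Eventually.of_forall fun z => ?_)
  simp [h.mul_zero, h.cocycle_neg]

/-- For `x` near `x₀` the integrands vanish off one compact set, so local integrability of `φ`
suffices; the result therefore applies to elements of `L^q`. -/
theorem continuous_tconv (h : IsTwistedGroup M A μ) [μ.IsAddHaarMeasure] {φ ψ : E → ℂ}
    (hφ : LocallyIntegrable φ μ) (hψ : Continuous ψ) (hψ' : HasCompactSupport ψ) :
    Continuous (tconv M A μ φ ψ) := by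
  rw [continuous_iff_continuousAt]
  intro x₀
  have hk : IsCompact ((fun q : E × E => M q.1 (-q.2)) ''
      (Metric.closedBall x₀ 1 ×ˢ tsupport ψ)) :=
    ((isCompact_closedBall x₀ 1).prod hψ').image
      (h.continuous_mul continuous_fst continuous_snd.neg)
  have hcont : Continuous (Function.uncurry fun x z : E =>
      Complex.exp (Complex.I * A z (M (-z) x)) * ψ (M (-z) x)) := by
    have h1 : Continuous fun q : E × E => M (-q.2) q.1 :=
      h.continuous_mul continuous_snd.neg continuous_fst
    exact (Complex.continuous_exp.comp (continuous_const.mul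
      (Complex.continuous_ofReal.comp (h.continuous_cocycle continuous_snd h1)))).mul (hψ.comp h1)
  have := continuousOn_integral_bilinear_of_locally_integrable_of_compact_support
    (ContinuousLinearMap.mul ℂ ℂ) (s := Metric.closedBall x₀ 1) hk hcont.continuousOn
    (fun x z hx hz => by
      have : ψ (M (-z) x) = 0 := by
        by_contra hne
        exact hz ⟨(x, M (-z) x), ⟨hx, subset_tsupport _ hne⟩, h.mul_neg_neg_mul x z⟩
      simp only [this, MulZeroClass.mul_zero])
    (hφ.integrableOn_isCompact hk)
  have h2 := this.continuousAt (Metric.closedBall_mem_nhds x₀ one_pos)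
  refine h2.congr (Eventually.of_forall fun x => ?_)
  rw [h.tconv_eq_integral]
  rfl

/-- `|R_{-y} φ(x)|` is at most `S(R_{-y} φ) W(x)` with `W` in `L^p`, and `y ↦ S(R_{-y} φ)` is
continuous, hence integrable against `|ψ|`. -/
theorem memLp_tconv (h : IsTwistedGroup M A μ) [μ.IsAddHaarMeasure] (p : ℝ≥0∞) (φ : 𝓢(E, ℂ))
    {ψ : E → ℂ} (hψ : Continuous ψ) (hψ' : HasCompactSupport ψ) :
    MemLp (tconv M A μ φ ψ) p μ := by
  obtain ⟨S, W, hS, -, hW, hWnn, hle⟩ := exists_norm_le_mul p μ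
  have hc := h.continuous_tconv φ.integrable.locallyIntegrable hψ hψ'
  refine ⟨hc.aestronglyMeasurable, ?_⟩
  have hint : Integrable (fun y => S (h.rtrans (-y) φ) * ‖ψ y‖) μ :=
    ((hS.comp ((h.continuous_rtrans φ).comp continuous_neg)).mul
      hψ.norm).integrable_of_hasCompactSupport hψ'.norm.mul_left
  refine (eLpNorm_le_mul_eLpNorm_of_ae_le_mul (c := ∫ y, S (h.rtrans (-y) φ) * ‖ψ y‖ ∂μ)
    (g := W) (Eventually.of_forall fun x => ?_) p).trans_lt (ENNReal.mul_lt_top (by simp) hW)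
  rw [h.tconv_eq_integral_rtrans, Real.norm_of_nonneg (hWnn x), ← integral_mul_const]
  refine norm_integral_le_of_norm_le (hint.mul_const _) (Eventually.of_forall fun y => ?_)
  rw [norm_mul, mul_right_comm]
  exact mul_le_mul_of_nonneg_right (hle _ x) (norm_nonneg _)

/-- Approximation of twisted translations by twisted convolutions, in the `L^p` norm. -/
theorem tendsto_eLpNorm_tconv (h : IsTwistedGroup M A μ) [μ.IsAddHaarMeasure] (p : ℝ≥0∞)
    (φ : 𝓢(E, ℂ)) (a : E) :
    Tendsto (fun n => eLpNorm (tconv M A μ φ (fun y => ((shrinkingBump (-a) n).normed μ y : ℂ)) -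
      ⇑(h.rtrans a φ)) p μ) atTop (𝓝 0) := by
  obtain ⟨S, W, hS, hS0, hW, hWnn, hle⟩ := exists_norm_le_mul p μ
  rw [ENNReal.tendsto_nhds_zero]
  intro ε hε
  obtain ⟨η, hη, hηε⟩ : ∃ η : ℝ, 0 < η ∧ ENNReal.ofReal η * eLpNorm W p μ ≤ ε := by
    obtain ⟨η, hη, hlt⟩ := ENNReal.exists_nnreal_pos_mul_lt hW.ne hε.ne'
    exact ⟨η, hη, by simpa using hlt.le⟩
  -- The bumps are centred at `-a` because twisted convolution averages the translations by `-y`.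
  have hnear : ∀ᶠ y in 𝓝 (-a), S (h.rtrans (-y) φ - h.rtrans a φ) < η := by
    have hc : Continuous fun y => S (h.rtrans (-y) φ - h.rtrans a φ) :=
      hS.comp (((h.continuous_rtrans φ).comp continuous_neg).sub continuous_const)
    refine (hc.tendsto (-a)).eventually_lt_const ?_
    rwa [neg_neg, sub_self, hS0]
  filter_upwards [eventually_ball_shrinkingBump hnear] with n hn
  refine (eLpNorm_le_mul_eLpNorm_of_ae_le_mul (c := η) (g := W)
    (Eventually.of_forall fun x => ?_) p).trans hηε
  rw [Pi.sub_apply, h.tconv_eq_integral_rtrans, Real.norm_of_nonneg (hWnn x)]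
  refine ContDiffBump.norm_integral_mul_normed_sub_le _ (h.contDiff_rtrans_neg_apply φ x).continuous
    fun y hy => ?_
  have := hle (h.rtrans (-y) φ - h.rtrans a φ) x
  rw [sub_apply] at this
  exact this.trans (mul_le_mul_of_nonneg_right (hn y hy).le (hWnn x))

/-- Approximation of twisted translations by twisted convolutions, pointwise. -/
theorem tendsto_tconv (h : IsTwistedGroup M A μ) [μ.IsAddHaarMeasure] {f : E → ℂ}
    (hf : Continuous f) (a x : E) :
    Tendsto (fun n => tconv M A μ f (fun y => ((shrinkingBump (-a) n).normed μ y : ℂ)) x) atTop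
      (𝓝 (Complex.exp (Complex.I * ((-A x a : ℝ) : ℂ)) * f (M x a))) := by
  have hG : Continuous fun y => f (M x (-y)) * Complex.exp (Complex.I * A (M x (-y)) y) := by
    have h1 : Continuous fun y => M x (-y) := h.continuous_mul continuous_const continuous_neg
    exact (hf.comp h1).mul (Complex.continuous_exp.comp (continuous_const.mul
      (Complex.continuous_ofReal.comp (h.continuous_cocycle h1 continuous_id))))
  rw [Metric.tendsto_nhds]
  intro ε hε
  have hnear := (Metric.tendsto_nhds.1 (hG.tendsto (-a))) (ε / 2) (half_pos hε)
  filter_upwards [eventually_ball_shrinkingBump hnear] with n hn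
  rw [dist_eq_norm]
  refine lt_of_le_of_lt ?_ (half_lt_self hε)
  refine ContDiffBump.norm_integral_mul_normed_sub_le _ hG fun y hy => ?_
  have := (hn y hy).le
  rw [dist_eq_norm, h.cocycle_mul_neg x (-a), neg_neg, mul_comm (f (M x a))] at this
  exact this

end IsTwistedGroup

/-! ### Operators commuting with right twisted convolutions. -/

/-- Integration against a continuous function with compact support is a continuous linear
functional on `L^q`. -/
lemma MeasureTheory.Lp.exists_clm_eq_integral_mul {E : Type*} [TopologicalSpace E]
    [MeasurableSpace E] [OpensMeasurableSpace E] {μ : Measure E} [IsFiniteMeasureOnCompacts μ]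
    {q : ℝ≥0∞} [hq : Fact (1 ≤ q)] {ψ : E → ℂ} (hψ : Continuous ψ) (hψ' : HasCompactSupport ψ) :
    ∃ T : Lp ℂ q μ →L[ℂ] ℂ, ∀ f : Lp ℂ q μ, T f = ∫ z, f z * ψ z ∂μ := by
  -- `(1 - q⁻¹)⁻¹` is the conjugate exponent; the conventions of `ℝ≥0∞` make it `∞` for `q = 1` and
  -- `1` for `q = ∞`.
  have := ENNReal.HolderConjugate.inv_one_sub_inv' hq.out
  have : Fact (1 ≤ (1 - q⁻¹)⁻¹) := by simp [fact_iff]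
  have hm : MemLp ψ (1 - q⁻¹)⁻¹ μ := hψ.memLp_of_hasCompactSupport hψ'
  refine ⟨((ContinuousLinearMap.mul ℂ ℂ).lpPairing μ q (1 - q⁻¹)⁻¹).flip (hm.toLp ψ), fun f => ?_⟩
  rw [ContinuousLinearMap.flip_apply, ContinuousLinearMap.lpPairing_eq_integral]
  refine integral_congr_ae ?_
  filter_upwards [hm.coeFn_toLp] with z hz
  rw [hz, ContinuousLinearMap.mul_apply']

namespace IsTwistedGroup

variable {E : Type*} [NormedAddCommGroup E] [InnerProductSpace ℝ E] [FiniteDimensional ℝ E]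
  [MeasurableSpace E] {M : E → E → E} {A : E → E → ℝ} {μ : Measure E} [μ.IsAddHaarMeasure]

/-- A functional is determined by the almost everywhere values of its twisted convolutions. -/
theorem eq_of_apply_rtrans_ae_eq (h : IsTwistedGroup M A μ) {u v : 𝓢(E, ℂ) → ℂ}
    (hu : Continuous u) (hv : Continuous v)
    (huv : ∀ φ : 𝓢(E, ℂ), (fun x => u (h.rtrans x φ)) =ᵐ[μ] fun x => v (h.rtrans x φ)) : u = v := by
  funext φ
  have := congrFun (((hu.comp (h.continuous_rtrans φ)).ae_eq_iff_eq μ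
    (hv.comp (h.continuous_rtrans φ))).1 (huv φ)) 0
  simpa only [Function.comp_apply, rtrans_zero] using this

variable [BorelSpace E] {p q : ℝ≥0∞} [Fact (1 ≤ p)] [Fact (1 ≤ q)] {C : Lp ℂ p μ →L[ℂ] Lp ℂ q μ}

theorem apply_tconv_ae_eq (h : IsTwistedGroup M A μ)
    (hC : ∀ φ ψ χ : Lp ℂ p μ, MemLp φ 1 μ → MemLp ψ 1 μ →
      χ =ᵐ[μ] tconv M A μ φ ψ → C χ =ᵐ[μ] tconv M A μ (C φ) ψ)
    (φ : 𝓢(E, ℂ)) {ψ : E → ℂ} (hψ : Continuous ψ) (hψ' : HasCompactSupport ψ) :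
    C ((h.memLp_tconv p φ hψ hψ').toLp _) =ᵐ[μ] tconv M A μ (C (φ.toLp p μ)) ψ := by
  have hm : MemLp ψ p μ := hψ.memLp_of_hasCompactSupport hψ'
  have := hC (φ.toLp p μ) (hm.toLp ψ) ((h.memLp_tconv p φ hψ hψ').toLp _)
    ((memLp_congr_ae (φ.coeFn_toLp p μ)).2 (φ.memLp 1 μ))
    ((memLp_congr_ae hm.coeFn_toLp).2 (hψ.memLp_of_hasCompactSupport hψ'))
    (by
      rw [h.tconv_congr_left (φ.coeFn_toLp p μ), tconv_congr_right _ hm.coeFn_toLp]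
      exact MemLp.coeFn_toLp _)
  rwa [tconv_congr_right _ hm.coeFn_toLp] at this

/-- The values of `C` on Schwartz functions are continuous functions, and evaluating them at the
origin is a continuous linear functional. -/
theorem exists_continuous_ae_eq (h : IsTwistedGroup M A μ)
    (hC : ∀ φ ψ χ : Lp ℂ p μ, MemLp φ 1 μ → MemLp ψ 1 μ →
      χ =ᵐ[μ] tconv M A μ φ ψ → C χ =ᵐ[μ] tconv M A μ (C φ) ψ) :
    ∃ (F : 𝓢(E, ℂ) → E → ℂ) (u : 𝓢(E, ℂ) →L[ℂ] ℂ), (∀ φ, Continuous (F φ)) ∧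
      (∀ φ, C (φ.toLp p μ) =ᵐ[μ] F φ) ∧ ∀ φ, F φ 0 = u φ := by
  obtain ⟨n, ψ, D, hψ, hψ', hD⟩ := h.exists_factorization
  have hT : ∀ i, ∃ T : Lp ℂ q μ →L[ℂ] ℂ, ∀ f : Lp ℂ q μ, T f = ∫ z, f z * ψ i (-z) ∂μ := fun i =>
    Lp.exists_clm_eq_integral_mul ((hψ i).comp continuous_neg)
      ((hψ' i).comp_homeomorph (Homeomorph.neg E))
  choose T hT using hT
  -- The continuous representative is `∑ C(D_i φ) ∗ ψ_i`; its value at `0` pairs `C(D_i φ)` with the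
  -- reflected `ψ_i`.
  refine ⟨fun φ x => ∑ i, tconv M A μ (C ((D i φ).toLp p μ)) (ψ i) x,
    ∑ i, (T i).comp (C.comp ((toLpCLM ℂ ℂ p μ).comp (D i))), fun φ => ?_, fun φ => ?_, fun φ => ?_⟩
  · exact continuous_finsetSum _ fun i _ => h.continuous_tconv
      ((Lp.memLp (C ((D i φ).toLp p μ))).locallyIntegrable Fact.out) (hψ i) (hψ' i)
  · have hφ : φ.toLp p μ = ∑ i, (h.memLp_tconv p (D i φ) (hψ i) (hψ' i)).toLp _ := by
      refine Lp.ext ?_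
      refine (φ.coeFn_toLp p μ).trans (Filter.EventuallyEq.trans ?_ (Lp.coeFn_finsetSum _ _).symm)
      have := ae_all_iff.2 fun i => (h.memLp_tconv p (D i φ) (hψ i) (hψ' i)).coeFn_toLp
      filter_upwards [this] with x hx
      rw [Finset.sum_apply, hD φ x]
      refine Finset.sum_congr rfl fun i _ => ?_
      rw [hx i, h.tconv_eq_integral_rtrans]
    rw [hφ, map_sum]
    refine (Lp.coeFn_finsetSum _ _).trans ?_
    have := ae_all_iff.2 fun i => h.apply_tconv_ae_eq hC (D i φ) (hψ i) (hψ' i)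
    filter_upwards [this] with x hx
    rw [Finset.sum_apply]
    exact Finset.sum_congr rfl fun i _ => hx i
  · rw [sum_apply]
    refine Finset.sum_congr rfl fun i _ => ?_
    rw [h.tconv_apply_zero, ContinuousLinearMap.comp_apply, hT]
    rfl

/-- `C` commutes with `R_a`. For bumps `ψ_n` at `-a`, `φ ∗ ψ_n` tends to `R_a φ` in `L^p`, so a
subsequence of `C(φ ∗ ψ_n) = Cφ ∗ ψ_n` tends almost everywhere to `C(R_a φ)`. As `Cφ` has the
continuous representative `f`, the same sequence tends pointwise to the twisted translate of `f`.
Continuity removes the exceptional set. -/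
theorem apply_rtrans_eq (h : IsTwistedGroup M A μ)
    (hC : ∀ φ ψ χ : Lp ℂ p μ, MemLp φ 1 μ → MemLp ψ 1 μ →
      χ =ᵐ[μ] tconv M A μ φ ψ → C χ =ᵐ[μ] tconv M A μ (C φ) ψ)
    {φ : 𝓢(E, ℂ)} {a : E} {f f' : E → ℂ} (hf : Continuous f) (hf' : Continuous f')
    (hφ : C (φ.toLp p μ) =ᵐ[μ] f) (hφ' : C ((h.rtrans a φ).toLp p μ) =ᵐ[μ] f') (x : E) :
    f' x = Complex.exp (Complex.I * ((-A x a : ℝ) : ℂ)) * f (M x a) := by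
  let ψ : ℕ → E → ℂ := fun n y => ((shrinkingBump (-a) n).normed μ y : ℂ)
  have hψ : ∀ n, Continuous (ψ n) := fun n =>
    Complex.continuous_ofReal.comp (shrinkingBump (-a) n).continuous_normed
  have hψ' : ∀ n, HasCompactSupport (ψ n) := fun n =>
    (shrinkingBump (-a) n).hasCompactSupport_normed.comp_left (g := fun t : ℝ => (t : ℂ))
      Complex.ofReal_zero
  have hlim : Filter.Tendsto (fun n => (h.memLp_tconv p φ (hψ n) (hψ' n)).toLp _) Filter.atTop
      (nhds ((h.rtrans a φ).toLp p μ)) := by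
    refine (Lp.tendsto_Lp_iff_tendsto_eLpNorm'' _ _ _ ((h.rtrans a φ).memLp p μ)).2 ?_
    exact h.tendsto_eLpNorm_tconv p φ a
  have hlim' := (C.continuous.tendsto _).comp hlim
  obtain ⟨ns, hns, hae⟩ := (tendstoInMeasure_of_tendsto_Lp hlim').exists_seq_tendsto_ae
  have hall := ae_all_iff.2 fun n => h.apply_tconv_ae_eq hC φ (hψ n) (hψ' n)
  have key : f' =ᵐ[μ] fun x => Complex.exp (Complex.I * ((-A x a : ℝ) : ℂ)) * f (M x a) := by
    filter_upwards [hall, hae, hφ'] with x hx hx' hx''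
    rw [← hx'']
    refine tendsto_nhds_unique hx' ?_
    refine ((h.tendsto_tconv hf a x).comp hns.tendsto_atTop).congr fun n => ?_
    rw [Function.comp_apply, Function.comp_apply, hx, h.tconv_congr_left hφ]
  have hg : Continuous fun x => Complex.exp (Complex.I * ((-A x a : ℝ) : ℂ)) * f (M x a) :=
    (Complex.continuous_exp.comp (continuous_const.mul (Complex.continuous_ofReal.comp
      (h.continuous_cocycle continuous_id continuous_const).neg))).mul
      (hf.comp (h.continuous_mul continuous_id continuous_const))
  exact congrFun ((hf'.ae_eq_iff_eq μ hg).1 key) x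

/-- An operator commuting with right twisted convolutions is a twisted convolution operator on
Schwartz functions. -/
theorem exists_clm_apply_rtrans (h : IsTwistedGroup M A μ)
    (hC : ∀ φ ψ χ : Lp ℂ p μ, MemLp φ 1 μ → MemLp ψ 1 μ →
      χ =ᵐ[μ] tconv M A μ φ ψ → C χ =ᵐ[μ] tconv M A μ (C φ) ψ) :
    ∃ u : 𝓢(E, ℂ) →L[ℂ] ℂ, ∀ φ : 𝓢(E, ℂ), C (φ.toLp p μ) =ᵐ[μ] fun x => u (h.rtrans x φ) := by
  obtain ⟨F, u, hF, hCF, hu⟩ := h.exists_continuous_ae_eq hC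
  refine ⟨u, fun φ => (hCF φ).trans (Filter.Eventually.of_forall fun x => ?_)⟩
  -- At the origin the phase is trivial and `0 · x = x`, so the value of `C(R_x φ)` there is that of
  -- `Cφ` at `x`.
  have := h.apply_rtrans_eq hC (hF φ) (hF (h.rtrans x φ)) (hCF φ) (hCF _) 0
  rw [hu, h.zero_mul, h.cocycle_zero_left] at this
  simpa using this.symm

end IsTwistedGroup

/-! ### Back to `g_e`: reflection and the main theorem. -/

namespace Pedersen

variable {g : Type*} [LieRing g] [LieAlgebra ℝ g] {m : ℕ} {X : Module.Basis (Fin (m + 1)) ℝ g}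
  {μ : Measure (EuclideanSpace ℝ (Fin m))}

/-- Composition of Schwartz functions with `x ↦ -x`. -/
noncomputable def reflect (E : Type*) [NormedAddCommGroup E] [NormedSpace ℝ E] :
    𝓢(E, ℂ) →L[ℂ] 𝓢(E, ℂ) :=
  compCLMOfContinuousLinearEquiv ℂ (ContinuousLinearEquiv.neg ℝ)

@[simp]
lemma reflect_apply {E : Type*} [NormedAddCommGroup E] [NormedSpace ℝ E] (φ : 𝓢(E, ℂ)) (x : E) :
    reflect E φ x = φ (-x) := rfl

lemma reflect_reflect {E : Type*} [NormedAddCommGroup E] [NormedSpace ℝ E] (φ : 𝓢(E, ℂ)) :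
    reflect E (reflect E φ) = φ := by
  ext x
  simp

/-- The test function paired with `u` is the reflected translate of `φ`; the phases match since
`α(-x, y) = -α(-y, x)`. -/
lemma isTwistedConvDistrib_iff (h : IsTwistedGroup (mulE X) (alpha X) μ)
    {u : 𝓢'(EuclideanSpace ℝ (Fin m), ℂ)} {φ : 𝓢(EuclideanSpace ℝ (Fin m), ℂ)}
    {f : EuclideanSpace ℝ (Fin m) → ℂ} :
    IsTwistedConvDistrib X u φ f ↔ f = fun x => u (reflect _ (h.rtrans x φ)) := by
  have hk : ∀ x y, reflect _ (h.rtrans x φ) y =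
      Complex.exp (Complex.I * alpha X (-x) y) * φ (mulE X (-y) x) := by
    intro x y
    have := h.cocycle_neg_neg (-y) x
    rw [neg_neg] at this
    rw [reflect_apply, h.rtrans_apply, this]
  constructor
  · intro hf
    funext x
    obtain ⟨k, hk', hfk⟩ := hf x
    rw [hfk]
    congr 1
    ext y
    rw [hk', hk]
  · rintro rfl x
    exact ⟨_, hk x, rfl⟩

end Pedersen

theorem proposition4p5
    {g : Type*} [LieRing g] [LieAlgebra ℝ g] [LieRing.IsNilpotent g]
    (hcenter : Module.finrank ℝ (LieAlgebra.center ℝ g) = 1)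
    {m : ℕ} (X : Module.Basis (Fin (m + 1)) ℝ g) (hX : Pedersen.IsJordanHolder X)
    {H : Type*} [NormedAddCommGroup H] [InnerProductSpace ℂ H] [CompleteSpace H]
    (π : g → (H →L[ℂ] H)) (hπ : Pedersen.IsSquareIntegrableRep X π)
    (μ : Measure (EuclideanSpace ℝ (Fin m))) [μ.IsAddHaarMeasure]
    (p q : ℝ≥0∞) [Fact (1 ≤ p)] [Fact (1 ≤ q)] (hpq : p ≤ q)
    (C : Lp ℂ p μ →L[ℂ] Lp ℂ q μ)
    (hC : ∀ φ ψ χ : Lp ℂ p μ, MemLp φ 1 μ → MemLp ψ 1 μ →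
      χ =ᵐ[μ] Pedersen.twistedConv X μ φ ψ →
        C χ =ᵐ[μ] Pedersen.twistedConv X μ (C φ) ψ) :
    ∃! u : 𝓢'(EuclideanSpace ℝ (Fin m), ℂ),
      ∀ φ : 𝓢(EuclideanSpace ℝ (Fin m), ℂ),
        ∃ f : EuclideanSpace ℝ (Fin m) → ℂ,
          Pedersen.IsTwistedConvDistrib X u φ f ∧ C (φ.toLp p μ) =ᵐ[μ] f := by
  have h : IsTwistedGroup (Pedersen.mulE X) (Pedersen.alpha X) μ := hπ.isTwistedGroup hX μ
  obtain ⟨u, hu⟩ := h.exists_clm_apply_rtrans hC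
  -- Reflection is an involution, so composing `u` with it cancels the reflection in
  -- `IsTwistedConvDistrib`.
  obtain ⟨w, hw⟩ : ∃ w : 𝓢'(EuclideanSpace ℝ (Fin m), ℂ), ∀ φ, w φ = u (Pedersen.reflect _ φ) :=
    ⟨ContinuousLinearMap.toPointwiseConvergenceCLM _ _ _ _ (u.comp (Pedersen.reflect _)),
      fun _ => rfl⟩
  refine ⟨w, fun φ => ⟨_, (Pedersen.isTwistedConvDistrib_iff h).2 rfl, (hu φ).trans (.of_eq ?_)⟩,
    fun v hv => ?_⟩
  · funext x
    rw [hw, Pedersen.reflect_reflect]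
  · have huv : (fun φ => v (Pedersen.reflect _ φ)) = u :=
      h.eq_of_apply_rtrans_ae_eq ((map_continuous v).comp (map_continuous _)) u.continuous
        fun φ => by
          obtain ⟨f, hf, hCf⟩ := hv φ
          rw [Pedersen.isTwistedConvDistrib_iff h] at hf
          subst hf
          exact hCf.symm.trans (hu φ)
    ext φ
    rw [hw, ← huv]
    exact congrArg v (Pedersen.reflect_reflect φ).symm
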